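/- Let $p$ be a prime, let $R_p=\widehat{\mathbb Z}_p^{ur}$ (the Witt vectors of an algebraic closure of $\mathbb F_p$) with its Frobenius lift $\phi$, let $\pi$ be a root of a monic Eisenstein polynomial of degree $e\ge 2$ over $\mathbb Z_p$, and let $R_\pi=R_p[\pi]$ with the extension of $\phi$ such that $\phi(\pi)=\pi$. Let $\hat{\ }$ denote $p$-adic completion. For an $R_p$-algebra $A$ let $(A^n)_{n\ge 0}$ be the universal sequence of rings over $R_p$ with $A^0=A$ and with compatible ring maps $A^n\to A^{n+1}$ and $p$-derivations $\delta_p:A^n\to A^{n+1}$ (so $\phi(a)=a^p+p\,\delta_p a$ is a ring homomorphism extending $\phi$ on $R_p$); explicitly, if $A=R_p[x]/I$ then $A^n=R_p[x,\delta_px,\dots,\delta_p^nx]/(I,\delta_pI,\dots,\delta_p^nI)$. For an $R_p$-scheme $V$ let $\mathcal O(J^n_p(V))$ be the ring of families of elements of $\widehat{\mathcal O(W)^n}$, $W\subset V$ affine open, compatible with restriction. Define in the same way, with $\pi$ and $R_\pi$ in place of $p$ and $R_p$ (so $\phi(a)=a^p+\pi\,\delta_\pi a$), the ring $\mathcal O(J^n_\pi(V_{R_\pi}))$,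 using the affine opens $W_{R_\pi}=\mathrm{Spec}(\mathcal O(W)\otimes_{R_p}R_\pi)$. There is a canonical map $$(*)\qquad \mathcal O(J^n_\pi(V_{R_\pi}))\to\mathcal O(J^n_p(V))\otimes_{R_p}R_\pi$$ compatible with the operators $\delta_\pi$, where on the right $\delta_\pi z=(\phi(z)-z^p)/\pi$. An element $f\in\mathcal O(J^n_p(V))$ is called $\delta_\pi$-overconvergent if, for some $\nu\ge 0$, either $p^\nu f$ is in the image of the composition of $(*)$ with $1\otimes \mathrm{Tr}_{R_\pi/R_p}$, or $p^\nu f\otimes 1$ is in the image of $(*)$. Let $V$ be a smooth $R_p$-scheme, let $1\le r\le e-1$, and let $f\in\mathcal O(J^r_p(V))$ be $\delta_\pi$-overconvergent. Then $f$ is $\delta_p$-overconvergent with radius $\ge p^{1/(p^{r-1}e)}$. That is, for every affine open $W\subset V$ and every closed embedding $W\subset\mathbb A^d=\mathrm{Spec}\,R_p[x]$ over $R_p$, the image of $f$ in $\mathcal O(J^r_p(W))$ is the image of a restricted power series $$F=\sum a_{\alpha,\beta}\,x^\alpha y^\beta\in R_p[x,y]\hat{\ }=\mathcal O(J^r_p(\mathbb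 A^d)),\qquad y=(\delta_px,\dots,\delta_p^rx),$$ for which there is a real number $C'>0$ with $v_p(a_{\alpha,\beta})\ge\dfrac{|\beta|}{p^{r-1}e}-C'$ for all $\alpha,\beta$. -/

import Mathlib

set_option linter.unusedSectionVars false

noncomputable section

namespace ArithJet

open MvPolynomial TensorProduct

/-- A ring `R` with a non-zero-divisor `unif` dividing `p` and a ring endomorphism `frob` lifting
the `p`-power map modulo `unif`. Such a ring carries the `unif`-derivation
`x ↦ (frob x - x ^ p) / unif`. It is used below only for `R_p` with `unif = p` (`baseP`) and for
`R_π` with `unif = π` (`basePi`). -/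
structure FrobBase (p : ℕ) (R : Type) [CommRing R] where
  unif : R
  frob : R →+* R
  unif_mem : unif ∈ nonZeroDivisors R
  dvd_p : unif ∣ (p : R)
  dvd_frob : ∀ x : R, unif ∣ frob x - x ^ p

/-- The polynomial ring `R[x, δx, …, δⁿx]`, where `x` is the tuple of variables indexed by `σ`;
the variable with index `(i, s)` is `δⁱ x_s`. -/
abbrev JetPoly (R σ : Type) [CommRing R] (n : ℕ) : Type := MvPolynomial (Fin (n + 1) × σ) R

namespace JetPoly

variable {p : ℕ} {R σ τ : Type} [CommRing R]

/-- The inclusion `R[x, …, δⁿx] → R[x, …, δⁿ⁺¹x]`. -/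
def incl (R σ : Type) [CommRing R] (n : ℕ) : JetPoly R σ n →ₐ[R] JetPoly R σ (n + 1) :=
  rename fun s => (s.1.castSucc, s.2)

/-- The ring homomorphism `φ : R[x, …, δⁿx] → R[x, …, δⁿ⁺¹x]` that is `frob` on `R` and sends
`δⁱ x_s` to `(δⁱ x_s) ^ p + c δⁱ⁺¹ x_s`. For `c = unif` the variables stand for the iterates of the
`unif`-derivation; for `R = R_π` and `c = p` they stand for the iterates of the `p`-derivation. -/
def Phi (B : FrobBase p R) (c : R) (σ : Type) (n : ℕ) : JetPoly R σ n →+* JetPoly R σ (n + 1) :=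
  eval₂Hom (C.comp B.frob) fun s => X (s.1.castSucc, s.2) ^ p + C c * X (s.1.succ, s.2)

theorem C_unif_mem (B : FrobBase p R) (ι : Type) :
    (C B.unif : MvPolynomial ι R) ∈ nonZeroDivisors (MvPolynomial ι R) := by
  rw [mem_nonZeroDivisors_iff_right]
  intro F hF
  ext m
  have := congrArg (coeff m) hF
  rw [mul_comm, coeff_C_mul, coeff_zero] at this
  rw [coeff_zero]
  exact (mem_nonZeroDivisors_iff_right.1 B.unif_mem) _ (by rw [mul_comm]; exact this)

theorem cancel (B : FrobBase p R) {ι : Type} {F G : MvPolynomial ι R}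
    (h : C B.unif * F = C B.unif * G) : F = G := by
  have h0 : (F - G) * C B.unif = 0 := by rw [mul_comm, mul_sub, h, sub_self]
  exact sub_eq_zero.1 ((mem_nonZeroDivisors_iff_right.1 (C_unif_mem B ι)) _ h0)

theorem dvd_Phi_sub [Fact p.Prime] (B : FrobBase p R) {c : R} (hc : B.unif ∣ c) (n : ℕ)
    (F : JetPoly R σ n) : C B.unif ∣ Phi B c σ n F - incl R σ n F ^ p := by
  set J : Ideal (JetPoly R σ (n + 1)) := Ideal.span {C B.unif} with hJ
  have hmem : ∀ r : R, B.unif ∣ r → (Ideal.Quotient.mk J (C r)) = 0 := by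
    rintro r ⟨t, rfl⟩
    rw [Ideal.Quotient.eq_zero_iff_mem, C_mul]
    exact Ideal.mul_mem_right _ _ (Ideal.mem_span_singleton_self _)
  have hchar : (p : JetPoly R σ (n + 1) ⧸ J) = 0 := by
    have := hmem _ B.dvd_p
    simpa using this
  have key : ∀ x y : JetPoly R σ (n + 1) ⧸ J, (x + y) ^ p = x ^ p + y ^ p := fun x y => by
    rw [add_pow_prime_eq (Fact.out : p.Prime), hchar, zero_mul, zero_mul,
      zero_mul, add_zero]
  rw [← Ideal.mem_span_singleton, ← Ideal.Quotient.eq_zero_iff_mem, map_sub, map_pow, sub_eq_zero]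
  induction F using MvPolynomial.induction_on with
  | C a =>
    have := hmem _ (B.dvd_frob a)
    rw [C_sub, C_pow, map_sub, map_pow, sub_eq_zero] at this
    simpa [Phi, incl] using this
  | add F G hF hG => rw [map_add, map_add, map_add, map_add, hF, hG, key]
  | mul_X F s hF =>
    rw [map_mul, map_mul, map_mul, map_mul, mul_pow, hF]
    congr 1
    have := hmem _ hc
    rw [Phi, eval₂Hom_X', map_add, map_mul, this, zero_mul, add_zero, map_pow]
    simp [incl]

/-- The `unif`-derivation `F ↦ (φ F - F ^ p) / unif` from `R[x, …, δⁿx]` to `R[x, …, δⁿ⁺¹x]`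
(the quotient is unique since `unif` is a non-zero-divisor, see `unif_mul_delta`). -/
def delta [Fact p.Prime] (B : FrobBase p R) {c : R} (hc : B.unif ∣ c) (n : ℕ)
    (F : JetPoly R σ n) : JetPoly R σ (n + 1) :=
  (dvd_Phi_sub B hc n F).choose

theorem unif_mul_delta [Fact p.Prime] (B : FrobBase p R) {c : R} (hc : B.unif ∣ c) (n : ℕ)
    (F : JetPoly R σ n) : C B.unif * delta B hc n F = Phi B c σ n F - incl R σ n F ^ p :=
  (dvd_Phi_sub B hc n F).choose_spec.symm

/-- The ideal of `R[x, …, δⁿx]` generated by `I, δI, …, δⁿI`, where `I` is an ideal of `R[x]`. -/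
def jetIdeal [Fact p.Prime] (B : FrobBase p R) {c : R} (hc : B.unif ∣ c)
    (I : Ideal (JetPoly R σ 0)) : (n : ℕ) → Ideal (JetPoly R σ n)
  | 0 => I
  | n + 1 => Ideal.span
      (incl R σ n '' (jetIdeal B hc I n : Set (JetPoly R σ n)) ∪
        delta B hc n '' (jetIdeal B hc I n : Set (JetPoly R σ n)))

theorem delta_comm [Fact p.Prime] (B : FrobBase p R) {c c' : R} (hc : B.unif ∣ c)
    (hc' : B.unif ∣ c') (n : ℕ) (f : JetPoly R σ n →ₐ[R] JetPoly R τ n)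
    (g : JetPoly R σ (n + 1) →ₐ[R] JetPoly R τ (n + 1))
    (hi : ∀ F, g (incl R σ n F) = incl R τ n (f F))
    (hP : ∀ F, g (Phi B c σ n F) = Phi B c' τ n (f F)) (F : JetPoly R σ n) :
    g (delta B hc n F) = delta B hc' n (f F) := by
  apply cancel B
  have h1 : (C B.unif : JetPoly R τ (n + 1)) = g (C B.unif) := (g.commutes B.unif).symm
  rw [unif_mul_delta, h1, ← map_mul, unif_mul_delta, map_sub, map_pow, hi, hP]

theorem jetIdeal_le [Fact p.Prime] (B : FrobBase p R) {c c' : R} (hc : B.unif ∣ c)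
    (hc' : B.unif ∣ c') (f : (n : ℕ) → JetPoly R σ n →ₐ[R] JetPoly R τ n)
    (hi : ∀ n F, f (n + 1) (incl R σ n F) = incl R τ n (f n F))
    (hP : ∀ n F, f (n + 1) (Phi B c σ n F) = Phi B c' τ n (f n F))
    {I : Ideal (JetPoly R σ 0)} {I' : Ideal (JetPoly R τ 0)} (h0 : ∀ F ∈ I, f 0 F ∈ I') :
    ∀ n, ∀ F ∈ jetIdeal B hc I n, f n F ∈ jetIdeal B hc' I' n
  | 0 => h0
  | n + 1 => by
    have ih := jetIdeal_le B hc hc' f hi hP h0 n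
    suffices jetIdeal B hc I (n + 1) ≤ (jetIdeal B hc' I' (n + 1)).comap (f (n + 1)) from
      fun F hF => this hF
    refine Ideal.span_le.2 ?_
    rintro _ (⟨F, hF, rfl⟩ | ⟨F, hF, rfl⟩)
    · exact Ideal.subset_span (Or.inl ⟨_, ih F hF, (hi n F).symm⟩)
    · exact Ideal.subset_span (Or.inr ⟨_, ih F hF,
        (delta_comm B hc hc' n (f n) (f (n + 1)) (hi n) (hP n) F).symm⟩)

theorem Phi_incl (B : FrobBase p R) (c : R) (n : ℕ) (F : JetPoly R σ n) :
    Phi B c σ (n + 1) (incl R σ n F) = incl R σ (n + 1) (Phi B c σ n F) := by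
  induction F using MvPolynomial.induction_on with
  | C a => simp [Phi, incl]
  | add F G hF hG => simp only [map_add, hF, hG]
  | mul_X F s hF =>
    rw [map_mul, map_mul, map_mul, map_mul, hF]
    congr 1
    simp [Phi, incl]

theorem delta_incl [Fact p.Prime] (B : FrobBase p R) {c : R} (hc : B.unif ∣ c) (n : ℕ)
    (F : JetPoly R σ n) :
    delta B hc (n + 1) (incl R σ n F) = incl R σ (n + 1) (delta B hc n F) := by
  apply cancel B
  have h1 : (C B.unif : JetPoly R σ (n + 2)) = incl R σ (n + 1) (C B.unif) :=
    ((incl R σ (n + 1)).commutes B.unif).symm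
  rw [unif_mul_delta, h1, ← map_mul, unif_mul_delta, map_sub, map_pow, Phi_incl]

end JetPoly

open JetPoly

section Jet
variable {p : ℕ} [Fact p.Prime] {R : Type} [CommRing R] (B : FrobBase p R)

/-- The ideal of relations of the `R`-algebra `A` in its tautological presentation, with one
variable for each element of `A`. -/
def relIdeal (R A : Type) [CommRing R] [CommRing A] [Algebra R A] : Ideal (JetPoly R A 0) :=
  RingHom.ker (aeval (fun s : Fin 1 × A => s.2) : JetPoly R A 0 →ₐ[R] A)

/-- The `n`-th term `Aⁿ` of the universal `unif`-prolongation sequence over `R` with `A⁰ = A`,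
namely `R[x, …, δⁿx] / (I, δI, …, δⁿI)` for the tautological presentation `A = R[x] / I`.
The class of the variable `(i, a)` is `δⁱ a`. -/
def JetAlg (A : Type) [CommRing A] [Algebra R A] (n : ℕ) : Type :=
  JetPoly R A n ⧸ jetIdeal B (dvd_refl B.unif) (relIdeal R A) n

instance (A : Type) [CommRing A] [Algebra R A] (n : ℕ) : CommRing (JetAlg B A n) :=
  Ideal.Quotient.commRing _

instance (A : Type) [CommRing A] [Algebra R A] (n : ℕ) : Algebra R (JetAlg B A n) :=
  Ideal.Quotient.algebra R

/-- The quotient map `R[x, …, δⁿx] → Aⁿ`. -/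
def JetAlg.mk (A : Type) [CommRing A] [Algebra R A] (n : ℕ) : JetPoly R A n →ₐ[R] JetAlg B A n :=
  Ideal.Quotient.mkₐ R (jetIdeal B (dvd_refl B.unif) (relIdeal R A) n)

theorem JetAlg.mk_eq_zero {A : Type} [CommRing A] [Algebra R A] {n : ℕ} (F : JetPoly R A n) :
    JetAlg.mk B A n F = 0 ↔ F ∈ jetIdeal B (dvd_refl B.unif) (relIdeal R A) n :=
  Ideal.Quotient.eq_zero_iff_mem

variable {A A' : Type} [CommRing A] [Algebra R A] [CommRing A'] [Algebra R A']

/-- Functoriality of the jet algebras: `δⁱ a ↦ δⁱ (u a)`. -/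
def JetAlg.map (u : A →ₐ[R] A') (n : ℕ) : JetAlg B A n →ₐ[R] JetAlg B A' n :=
  Ideal.quotientMapₐ _ (rename fun s : Fin (n + 1) × A => (s.1, u s.2)) <| by
    refine fun F hF => jetIdeal_le B _ _
      (fun n => rename fun s : Fin (n + 1) × A => (s.1, u s.2)) ?_ ?_ ?_ n F hF
    · intro n F
      simp only [incl, rename_rename]; rfl
    · intro n F
      induction F using MvPolynomial.induction_on with
      | C a => simp [Phi]
      | add F G hF hG => simp only [map_add, hF, hG]
      | mul_X F s hF =>
        rw [map_mul, map_mul, map_mul, map_mul, hF]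
        congr 1
        simp [Phi]
    · intro F hF
      rw [relIdeal, RingHom.mem_ker] at hF ⊢
      have : ((aeval fun s : Fin 1 × A' => s.2).comp
          (rename fun s : Fin (0 + 1) × A => (s.1, u s.2)) : JetPoly R A 0 →ₐ[R] A') =
          u.comp (aeval fun s : Fin 1 × A => s.2) := by
        ext s; simp
      have h := DFunLike.congr_fun this F
      simp only [AlgHom.comp_apply] at h
      rw [h, hF, map_zero]

end Jet

section Base
open Polynomial
variable (p : ℕ) [Fact p.Prime]

/-- `R_p`, the completion of the maximal unramified extension of `ℤ_p`, i.e. the ring of Witt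
vectors of an algebraic closure of `𝔽_p`. -/
abbrev Rp : Type := WittVector p (AlgebraicClosure (ZMod p))

/-- The inclusion `ℤ_p → R_p`. -/
def padicToRp : ℤ_[p] →+* Rp p :=
  (WittVector.map (algebraMap (ZMod p) (AlgebraicClosure (ZMod p)))).comp
    (WittVector.equiv p).symm.toRingHom

theorem frob_padicToRp (x : ℤ_[p]) :
    WittVector.frobenius (padicToRp p x) = padicToRp p x := by
  ext n
  rw [WittVector.coeff_frobenius_charP]
  simp only [padicToRp, RingHom.comp_apply, WittVector.map_coeff]
  rw [← map_pow]
  congr 1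
  exact ZMod.pow_card _

theorem padicToRp_injective : Function.Injective (padicToRp p) := by
  have h1 := WittVector.map_injective (p := p) _
    (algebraMap (ZMod p) (AlgebraicClosure (ZMod p))).injective
  exact fun x y h => (WittVector.equiv p).symm.injective (h1 h)

theorem p_dvd_frob_sub (x : Rp p) : (p : Rp p) ∣ WittVector.frobenius x - x ^ p := by
  rw [← Ideal.mem_span_singleton, ← WittVector.ker_constantCoeff, RingHom.mem_ker, map_sub,
    map_pow, sub_eq_zero]
  exact WittVector.coeff_frobenius_charP p x 0

/-- `R_p` with `unif = p` and the Frobenius lift. -/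
def baseP : FrobBase p (Rp p) where
  unif := p
  frob := WittVector.frobenius
  unif_mem := mem_nonZeroDivisors_of_ne_zero (WittVector.p_nonzero p _)
  dvd_p := dvd_rfl
  dvd_frob := p_dvd_frob_sub p

/-- A (monic) Eisenstein polynomial of degree `e ≥ 2` with coefficients in `ℤ_p`. -/
structure EisensteinPoly where
  poly : ℤ_[p][X]
  monic : poly.Monic
  eisenstein : poly.IsEisensteinAt (Ideal.span {(p : ℤ_[p])})
  two_le_natDegree : 2 ≤ poly.natDegree

variable {p} (E : EisensteinPoly p)

/-- The Eisenstein polynomial viewed over `R_p`. -/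
def EisensteinPoly.polyRp : (Rp p)[X] := E.poly.map (padicToRp p)

/-- `R_π = R_p[π]`, where `π` is a root of the Eisenstein polynomial. -/
abbrev Rpi : Type := AdjoinRoot E.polyRp

/-- The element `π` of `R_π`. -/
def Rpi.unif : Rpi E := AdjoinRoot.root _

theorem monic_polyRp : E.polyRp.Monic := E.monic.map _

instance : Module.Free (Rp p) (Rpi E) := (monic_polyRp E).free_adjoinRoot
instance : Module.Finite (Rp p) (Rpi E) := (monic_polyRp E).finite_adjoinRoot

/-- The ring endomorphism `φ` of `R_π` extending the Frobenius of `R_p` with `φ π = π`. -/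
def Rpi.frob : Rpi E →+* Rpi E :=
  AdjoinRoot.lift ((AdjoinRoot.of _).comp WittVector.frobenius) (AdjoinRoot.root _) <| by
    have h : E.polyRp.map WittVector.frobenius = E.polyRp := by
      rw [EisensteinPoly.polyRp, Polynomial.map_map]
      congr 1
      ext x : 1
      exact frob_padicToRp p x
    rw [← Polynomial.eval₂_map, h]
    exact AdjoinRoot.eval₂_root _

theorem Rpi.unif_dvd_coeff_zero :
    Rpi.unif E ∣ algebraMap (Rp p) (Rpi E) (E.polyRp.coeff 0) := by
  have h0 : AdjoinRoot.mk E.polyRp E.polyRp = 0 := AdjoinRoot.mk_self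
  have h1 := congrArg (AdjoinRoot.mk E.polyRp) (Polynomial.X_mul_divX_add E.polyRp)
  rw [h0, map_add, map_mul, AdjoinRoot.mk_X, AdjoinRoot.mk_C] at h1
  exact ⟨-AdjoinRoot.mk E.polyRp E.polyRp.divX, by
    rw [mul_neg, eq_neg_iff_add_eq_zero, add_comm]; exact h1⟩

theorem Rpi.coeff_zero_ne : E.polyRp.coeff 0 ≠ 0 := by
  rw [EisensteinPoly.polyRp, Polynomial.coeff_map]
  intro h
  rw [← map_zero (padicToRp p)] at h
  exact E.eisenstein.notMem (by rw [padicToRp_injective p h]; exact zero_mem _)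

theorem Rpi.unif_dvd_p : Rpi.unif E ∣ (p : Rpi E) := by
  obtain ⟨u, hu⟩ := Ideal.mem_span_singleton.1
    (E.eisenstein.mem (n := 0) (by have := E.two_le_natDegree; omega))
  have hunit : IsUnit u := by
    by_contra hn
    have := (PadicInt.mem_nonunits.1 hn)
    have hd : (p : ℤ_[p]) ∣ u := by
      rw [← Ideal.mem_span_singleton, ← PadicInt.maximalIdeal_eq_span_p]
      exact hn
    apply E.eisenstein.notMem
    rw [Ideal.span_singleton_pow, Ideal.mem_span_singleton, hu, pow_two]
    exact mul_dvd_mul_left _ hd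
  have h := Rpi.unif_dvd_coeff_zero E
  have hc : E.polyRp.coeff 0 = p * padicToRp p u := by
    rw [EisensteinPoly.polyRp, Polynomial.coeff_map, hu, map_mul, map_natCast]
  rw [hc, map_mul, map_natCast] at h
  exact ((hunit.map (padicToRp p)).map (algebraMap (Rp p) (Rpi E))).dvd_mul_right.1 h

theorem Rpi.unif_mem : Rpi.unif E ∈ nonZeroDivisors (Rpi E) := by
  rw [mem_nonZeroDivisors_iff_right]
  intro z hz
  obtain ⟨w, hw⟩ := Rpi.unif_dvd_coeff_zero E
  have h : E.polyRp.coeff 0 • z = 0 := by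
    rw [Algebra.smul_def, hw, mul_right_comm, mul_comm _ z, hz, zero_mul]
  exact (smul_eq_zero.1 h).resolve_left (Rpi.coeff_zero_ne E)

theorem Rpi.dvd_frob (x : Rpi E) : Rpi.unif E ∣ Rpi.frob E x - x ^ p := by
  have hchar : (p : Rpi E ⧸ Ideal.span {Rpi.unif E}) = 0 := by
    have := Ideal.Quotient.eq_zero_iff_mem.2 (Ideal.mem_span_singleton.2 (Rpi.unif_dvd_p E))
    simpa using this
  have key : ∀ x y : Rpi E ⧸ Ideal.span {Rpi.unif E}, (x + y) ^ p = x ^ p + y ^ p :=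
    fun x y => by
      rw [add_pow_prime_eq (Fact.out : p.Prime), hchar, zero_mul, zero_mul, zero_mul, add_zero]
  have hroot : Ideal.Quotient.mk (Ideal.span {Rpi.unif E}) (AdjoinRoot.root E.polyRp) = 0 :=
    Ideal.Quotient.eq_zero_iff_mem.2 (Ideal.mem_span_singleton_self _)
  have hp : p ≠ 0 := (Fact.out : p.Prime).ne_zero
  rw [← Ideal.mem_span_singleton, ← Ideal.Quotient.eq_zero_iff_mem, map_sub, map_pow, sub_eq_zero]
  obtain ⟨F, rfl⟩ := AdjoinRoot.mk_surjective x
  induction F using Polynomial.induction_on with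
  | C a =>
    have h := (map_dvd (algebraMap (Rp p) (Rpi E)) (p_dvd_frob_sub p a))
    rw [map_natCast] at h
    have h2 := Ideal.Quotient.eq_zero_iff_mem.2
      (Ideal.mem_span_singleton.2 ((Rpi.unif_dvd_p E).trans h))
    rw [map_sub, map_sub, map_pow, map_pow, sub_eq_zero] at h2
    rw [AdjoinRoot.mk_C, Rpi.frob, AdjoinRoot.lift_of]
    exact h2
  | add F G hF hG => rw [map_add, map_add, map_add, map_add, hF, hG, key]
  | monomial n a _ =>
    rw [map_mul, map_pow, AdjoinRoot.mk_X, map_mul, map_mul, map_mul, map_pow, map_pow, map_pow, Rpi.frob,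
      AdjoinRoot.lift_root, hroot, zero_pow (Nat.succ_ne_zero n), mul_zero, mul_zero,
      zero_pow hp]

/-- `R_π` with `unif = π` and its Frobenius lift fixing `π`. -/
def basePi : FrobBase p (Rpi E) where
  unif := Rpi.unif E
  frob := Rpi.frob E
  unif_mem := Rpi.unif_mem E
  dvd_p := Rpi.unif_dvd_p E
  dvd_frob := Rpi.dvd_frob E

end Base

section Completion

variable (p : ℕ)

/-- The `p`-adic completion of a ring. -/
abbrev PHat (A : Type) [CommRing A] : Type := AdicCompletion (Ideal.span {(p : A)}) A

theorem span_pow_le_comap {A A' : Type} [CommRing A] [CommRing A'] (u : A →+* A') (m : ℕ) :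
    Ideal.span {(p : A)} ^ m ≤ (Ideal.span {(p : A')} ^ m).comap u := by
  rw [← Ideal.map_le_iff_le_comap, Ideal.map_pow, Ideal.map_span, Set.image_singleton, map_natCast]

/-- The map from the `p`-adic completion of `A` to `A' / p ^ m` induced by `A → A'`. -/
def modPow {A A' : Type} [CommRing A] [CommRing A'] (u : A →+* A') (m : ℕ) :
    PHat p A →+* A' ⧸ Ideal.span {(p : A')} ^ m :=
  (Ideal.quotientMap _ u (span_pow_le_comap p u m)).comp
    (AdicCompletion.evalₐ (Ideal.span {(p : A)}) m : _ →+* _)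

theorem modPow_compat {A A' : Type} [CommRing A] [CommRing A'] (u : A →+* A') {m n : ℕ}
    (h : m ≤ n) :
    (Ideal.Quotient.factorPow (Ideal.span {(p : A')}) h).comp (modPow p u n) = modPow p u m := by
  ext x
  obtain ⟨x, rfl⟩ := AdicCompletion.mk_surjective _ _ x
  simp only [modPow, RingHom.comp_apply, RingHom.coe_coe, AdicCompletion.evalₐ_mk,
    Ideal.quotientMap_mk, Ideal.Quotient.factor_mk]
  rw [← Ideal.quotientMap_mk (H := span_pow_le_comap p u m),
    ← Ideal.quotientMap_mk (H := span_pow_le_comap p u m)]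
  congr 1
  exact AdicCompletion.Ideal.mk_eq_mk _ h x

/-- The canonical map from a ring to its `p`-adic completion. -/
def PHat.of {R A : Type} [CommRing R] [CommRing A] [Algebra R A] : A →ₐ[R] PHat p A where
  toRingHom := algebraMap A (PHat p A)
  commutes' _ := rfl

/-- The map induced on `p`-adic completions. -/
def PHat.map {A A' : Type} [CommRing A] [CommRing A'] (u : A →+* A') : PHat p A →+* PHat p A' :=
  AdicCompletion.liftRingHom _ (modPow p u) (fun h => modPow_compat p u h)

/-- The extension of a ring homomorphism to a `p`-adically complete ring to the completion. -/
def PHat.lift {A A' : Type} [CommRing A] [CommRing A'] [IsAdicComplete (Ideal.span {(p : A')}) A']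
    (u : A →+* A') : PHat p A →+* A' :=
  IsAdicComplete.liftRingHom _ (modPow p u) (fun h => modPow_compat p u h)

theorem smodEq_iff {R M : Type} [CommRing R] [AddCommGroup M] [Module R M] (n : ℕ) (x y : M) :
    x ≡ y [SMOD (Ideal.span {(p : R)} ^ n • ⊤ : Submodule R M)] ↔
      ∃ z : M, x - y = ((p : R) ^ n) • z := by
  rw [SModEq.sub_mem, Ideal.span_singleton_pow, Submodule.ideal_span_singleton_smul,
    Submodule.mem_smul_pointwise_iff_exists]
  exact ⟨fun ⟨z, _, hz⟩ => ⟨z, hz.symm⟩, fun ⟨z, hz⟩ => ⟨z, trivial, hz.symm⟩⟩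

theorem isAdicComplete_span_iff {R A : Type} [CommRing R] [CommRing A] [Algebra R A] :
    IsAdicComplete (Ideal.span {(p : A)}) A ↔ IsAdicComplete (Ideal.span {(p : R)}) A := by
  rw [← IsAdicComplete.map_algebraMap_iff (R := R) (S := A), Ideal.map_span, Set.image_singleton,
    map_natCast]

theorem isAdicComplete_tensor {R S M : Type} [CommRing R] [CommRing S] [Algebra R S]
    [Module.Free R S] [Module.Finite R S] [CommRing M] [Algebra R M]
    [h : IsAdicComplete (Ideal.span {(p : M)}) M] :
    IsAdicComplete (Ideal.span {(p : S ⊗[R] M)}) (S ⊗[R] M) := by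
  rw [isAdicComplete_span_iff (R := R)] at h ⊢
  let e := TensorProduct.equivFinsuppOfBasisLeft (N := M) (Module.Free.chooseBasis R S)
  have hh : IsHausdorff (Ideal.span {(p : R)}) (S ⊗[R] M) := by
    refine ⟨fun x hx => e.injective (Finsupp.ext fun i => ?_)⟩
    rw [map_zero, Finsupp.zero_apply]
    refine h.toIsHausdorff.haus _ fun n => ?_
    obtain ⟨z, hz⟩ := (smodEq_iff p n _ _).1 (hx n)
    rw [sub_zero] at hz
    exact (smodEq_iff p n _ _).2 ⟨e z i, by rw [hz, map_smul, sub_zero, Finsupp.smul_apply]⟩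
  have hp : IsPrecomplete (Ideal.span {(p : R)}) (S ⊗[R] M) := by
    refine ⟨fun f hf => ?_⟩
    have hc : ∀ i, ∃ L : M, ∀ n, e (f n) i ≡ L
        [SMOD (Ideal.span {(p : R)} ^ n • ⊤ : Submodule R M)] := fun i => by
      refine h.toIsPrecomplete.prec (f := fun n => e (f n) i) fun {m n} hmn => ?_
      obtain ⟨z, hz⟩ := (smodEq_iff p m _ _).1 (hf hmn)
      exact (smodEq_iff p m _ _).2 ⟨e z i, by
        rw [← Finsupp.sub_apply, ← map_sub, hz, map_smul, Finsupp.smul_apply]⟩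
    choose L hL using hc
    refine ⟨e.symm (Finsupp.equivFunOnFinite.symm L), fun n => ?_⟩
    have hz : ∀ i, ∃ z : M, e (f n) i - L i = ((p : R) ^ n) • z :=
      fun i => (smodEq_iff p n _ _).1 (hL i n)
    choose z hz using hz
    refine (smodEq_iff p n _ _).2 ⟨e.symm (Finsupp.equivFunOnFinite.symm z), e.injective ?_⟩
    ext i
    simp [hz]
  exact { hh, hp with }

instance PHat.complete (A : Type) [CommRing A] :
    IsAdicComplete (Ideal.span {(p : PHat p A)}) (PHat p A) := by
  rw [isAdicComplete_span_iff (R := A)]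
  exact AdicCompletion.isAdicComplete ⟨{(p : A)}, by simp⟩

end Completion

section Comparison

variable {p : ℕ} [Fact p.Prime] (E : EisensteinPoly p) (A : Type) [CommRing A] [Algebra (Rp p) A]

/-- The presentation `R_π[x] → R_π ⊗ A` with one variable for each element of `A`. -/
def kappa : JetPoly (Rpi E) A 0 →ₐ[Rpi E] Rpi E ⊗[Rp p] A :=
  aeval fun s : Fin 1 × A => (1 : Rpi E) ⊗ₜ[Rp p] s.2

theorem kappa_surjective : Function.Surjective (kappa E A) := by
  intro z
  induction z using TensorProduct.induction_on with
  | zero => exact ⟨0, map_zero _⟩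
  | tmul r a =>
    exact ⟨C r * X (0, a), by
      rw [map_mul, kappa, aeval_X, algHom_C, Algebra.TensorProduct.algebraMap_apply,
        Algebra.TensorProduct.tmul_mul_tmul]
      simp⟩
  | add x y hx hy =>
    obtain ⟨F, rfl⟩ := hx
    obtain ⟨G, rfl⟩ := hy
    exact ⟨F + G, map_add _ _ _⟩

/-- For `b ∈ R_π ⊗ A`, the element `δ_π ⁱ b̃` of `R_π[x, δ_p x, …, δ_p ⁿ x]`, where `b̃ ∈ R_π[x]`
is a lift of `b`. -/
def iterDelta : (n : ℕ) → Fin (n + 1) → (Rpi E ⊗[Rp p] A) → JetPoly (Rpi E) A n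
  | 0, _, b => Function.surjInv (kappa_surjective E A) b
  | n + 1, i, b => Fin.lastCases (delta (basePi E) (basePi E).dvd_p n (iterDelta n (Fin.last n) b))
      (fun j => incl (Rpi E) A n (iterDelta n j b)) i

theorem iterDelta_castSucc (n : ℕ) (j : Fin (n + 1)) (b : Rpi E ⊗[Rp p] A) :
    iterDelta E A (n + 1) j.castSucc b = incl (Rpi E) A n (iterDelta E A n j b) := by
  rw [iterDelta, Fin.lastCases_castSucc]

theorem iterDelta_succ (n : ℕ) (j : Fin (n + 1)) (b : Rpi E ⊗[Rp p] A) :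
    iterDelta E A (n + 1) j.succ b =
      delta (basePi E) (basePi E).dvd_p n (iterDelta E A n j b) := by
  induction n with
  | zero =>
    obtain rfl : j = Fin.last 0 := Subsingleton.elim (α := Fin 1) _ _
    rw [Fin.succ_last]
    exact Fin.lastCases_last
  | succ n ih =>
    induction j using Fin.lastCases with
    | last => rw [Fin.succ_last, iterDelta, Fin.lastCases_last]
    | cast j => rw [Fin.succ_castSucc, iterDelta_castSucc, iterDelta_castSucc, ih, delta_incl]

/-- The map `δ_π ⁱ b ↦ δ_π ⁱ b̃` from polynomials in the `δ_π ⁱ b`, `b ∈ R_π ⊗ A`, to polynomials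
in the `δ_p ⁱ a`, `a ∈ A`, with coefficients in `R_π`. -/
def theta (n : ℕ) :
    JetPoly (Rpi E) (Rpi E ⊗[Rp p] A) n →ₐ[Rpi E] JetPoly (Rpi E) A n :=
  aeval fun s => iterDelta E A n s.1 s.2

theorem theta_mem (n : ℕ) (F : JetPoly (Rpi E) (Rpi E ⊗[Rp p] A) n)
    (hF : F ∈ jetIdeal (basePi E) (dvd_refl _) (relIdeal (Rpi E) (Rpi E ⊗[Rp p] A)) n) :
    theta E A n F ∈ jetIdeal (basePi E) (basePi E).dvd_p (RingHom.ker (kappa E A)) n := by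
  refine jetIdeal_le (basePi E) _ _ (theta E A) ?_ ?_ ?_ n F hF
  · intro n F
    have : (theta E A (n + 1)).comp (incl _ _ n) = (incl _ _ n).comp (theta E A n) := by
      ext s
      simp [theta, incl, iterDelta_castSucc]
    exact DFunLike.congr_fun this F
  · intro n F
    induction F using MvPolynomial.induction_on with
    | C a => simp [Phi, theta, algHom_C, algebraMap_eq]
    | add F G hF hG => simp only [map_add, hF, hG]
    | mul_X F s hF =>
      rw [map_mul, map_mul, map_mul, map_mul, hF]
      congr 1
      have h := unif_mul_delta (basePi E) (basePi E).dvd_p n (iterDelta E A n s.1 s.2)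
      simp only [Phi, theta, eval₂Hom_X', aeval_X, map_add, map_mul, map_pow, iterDelta_castSucc,
        iterDelta_succ, algHom_C, algebraMap_eq] at h ⊢
      rw [h]
      ring
  · intro F hF
    rw [relIdeal, RingHom.mem_ker] at hF
    rw [RingHom.mem_ker, ← hF, ← AlgHom.comp_apply]
    congr 1
    ext s : 1
    simp [theta, iterDelta, Function.surjInv_eq]

/-- Extension of coefficients from `R_p` to `R_π`. -/
def coeffMap (n : ℕ) : JetPoly (Rp p) A n →+* JetPoly (Rpi E) A n :=
  MvPolynomial.map (algebraMap (Rp p) (Rpi E))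

/-- The ideal generated over `R_π` by the relations of the `p`-jet algebra. -/
def extIdeal (n : ℕ) : Ideal (JetPoly (Rpi E) A n) :=
  (jetIdeal (baseP p) (dvd_refl _) (relIdeal (Rp p) A) n).map (coeffMap E A n)

theorem ker_kappa_le : RingHom.ker (kappa E A) ≤ extIdeal E A 0 := by
  intro F hF
  let g : JetPoly (Rp p) A 0 →ₐ[Rp p] A := aeval fun s => s.2
  have hg : Function.Surjective g := fun a => ⟨X (0, a), by simp [g]⟩
  let e := MvPolynomial.algebraTensorAlgEquiv (σ := Fin (0 + 1) × A) (Rp p) (Rpi E)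
  have hk : (Algebra.TensorProduct.map (AlgHom.id (Rpi E) (Rpi E)) g).comp e.symm.toAlgHom =
      kappa E A := by
    ext s
    simp [e, g, kappa]
  have hmem : e.symm F ∈ RingHom.ker (Algebra.TensorProduct.map (AlgHom.id (Rp p) (Rpi E)) g) := by
    rw [← hk] at hF
    exact hF
  rw [Algebra.TensorProduct.lTensor_ker g hg] at hmem
  have h3 : (e.toAlgHom.toRingHom).comp
      (Algebra.TensorProduct.includeRight :
        JetPoly (Rp p) A 0 →ₐ[Rp p] Rpi E ⊗[Rp p] JetPoly (Rp p) A 0).toRingHom =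
      coeffMap E A 0 := by
    ext s
    · simp [e, coeffMap]
    · simp [e, coeffMap]
  have h2 : e.toAlgHom.toRingHom (e.symm F) ∈ Ideal.map e.toAlgHom.toRingHom (Ideal.map
      (Algebra.TensorProduct.includeRight :
        JetPoly (Rp p) A 0 →ₐ[Rp p] Rpi E ⊗[Rp p] JetPoly (Rp p) A 0).toRingHom
      (RingHom.ker g)) := Ideal.mem_map_of_mem _ hmem
  have h4 : e.toAlgHom.toRingHom (e.symm F) = F := e.apply_symm_apply F
  rw [Ideal.map_map, h3, h4] at h2
  exact h2

theorem incl_coeffMap (n : ℕ) (F : JetPoly (Rp p) A n) :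
    incl (Rpi E) A n (coeffMap E A n F) = coeffMap E A (n + 1) (incl (Rp p) A n F) :=
  (MvPolynomial.map_rename _ _ _).symm

theorem Phi_coeffMap (n : ℕ) (F : JetPoly (Rp p) A n) :
    Phi (basePi E) p A n (coeffMap E A n F) =
      coeffMap E A (n + 1) (Phi (baseP p) (baseP p).unif A n F) := by
  induction F using MvPolynomial.induction_on with
  | C a =>
    simp only [Phi, coeffMap, MvPolynomial.map_C, coe_eval₂Hom, eval₂_C, RingHom.comp_apply]
    congr 1
    change Rpi.frob E (AdjoinRoot.of _ a) = _
    rw [Rpi.frob, AdjoinRoot.lift_of]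
    rfl
  | add F G hF hG => simp only [map_add, hF, hG]
  | mul_X F s hF =>
    rw [map_mul, map_mul, map_mul, map_mul, hF]
    congr 1
    simp [Phi, coeffMap, baseP]

theorem delta_coeffMap_mem (n : ℕ) {F : JetPoly (Rp p) A n}
    (hF : F ∈ jetIdeal (baseP p) (dvd_refl _) (relIdeal (Rp p) A) n) :
    delta (basePi E) (basePi E).dvd_p n (coeffMap E A n F) ∈ extIdeal E A (n + 1) := by
  obtain ⟨w, hw⟩ := (basePi E).dvd_p
  have h : delta (basePi E) (basePi E).dvd_p n (coeffMap E A n F) =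
      C w * coeffMap E A (n + 1) (delta (baseP p) (dvd_refl _) n F) := by
    apply cancel (basePi E)
    have h1 : coeffMap E A (n + 1) (C (baseP p).unif) = C (basePi E).unif * C w := by
      rw [← C_mul, ← hw]
      simp [coeffMap, baseP]
    rw [← mul_assoc, ← h1, ← map_mul, unif_mul_delta, unif_mul_delta, map_sub, map_pow,
      Phi_coeffMap, incl_coeffMap]
  rw [h]
  exact Ideal.mul_mem_left _ _ (Ideal.mem_map_of_mem _
    (Ideal.subset_span (Or.inr ⟨F, hF, rfl⟩)))

theorem extIdeal_stable (n : ℕ) {F : JetPoly (Rpi E) A n} (hF : F ∈ extIdeal E A n) :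
    incl (Rpi E) A n F ∈ extIdeal E A (n + 1) ∧
      delta (basePi E) (basePi E).dvd_p n F ∈ extIdeal E A (n + 1) := by
  have hi : ∀ G ∈ extIdeal E A n, incl (Rpi E) A n G ∈ extIdeal E A (n + 1) := by
    suffices extIdeal E A n ≤ (extIdeal E A (n + 1)).comap (incl (Rpi E) A n) from
      fun G hG => this hG
    refine Ideal.map_le_iff_le_comap.2 fun G hG => ?_
    change incl (Rpi E) A n (coeffMap E A n G) ∈ extIdeal E A (n + 1)
    rw [incl_coeffMap]
    exact Ideal.mem_map_of_mem _ (Ideal.subset_span (Or.inl ⟨G, hG, rfl⟩))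
  refine ⟨hi F hF, ?_⟩
  obtain ⟨w, hw⟩ := (basePi E).dvd_p
  have h0 : delta (basePi E) (basePi E).dvd_p n (0 : JetPoly (Rpi E) A n) = 0 := by
    apply cancel (basePi E)
    rw [unif_mul_delta, map_zero, map_zero, mul_zero, zero_pow (Fact.out : p.Prime).ne_zero,
      sub_zero]
  have hmul : ∀ a G : JetPoly (Rpi E) A n, delta (basePi E) (basePi E).dvd_p n (a * G) =
      Phi (basePi E) p A n a * delta (basePi E) (basePi E).dvd_p n G +
        delta (basePi E) (basePi E).dvd_p n a * incl (Rpi E) A n G ^ p := by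
    intro a G
    apply cancel (basePi E)
    rw [mul_add, mul_left_comm, unif_mul_delta, ← mul_assoc (C _), unif_mul_delta, unif_mul_delta,
      map_mul, map_mul, mul_pow]
    ring
  have hadd : ∀ G H : JetPoly (Rpi E) A n, ∃ t, delta (basePi E) (basePi E).dvd_p n (G + H) =
      delta (basePi E) (basePi E).dvd_p n G + delta (basePi E) (basePi E).dvd_p n H +
        incl (Rpi E) A n G * t := by
    intro G H
    have hq := add_pow_prime_eq (Fact.out : p.Prime) (incl (Rpi E) A n G) (incl (Rpi E) A n H)
    have hpw : (p : JetPoly (Rpi E) A (n + 1)) = C (basePi E).unif * C w := by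
      rw [← C_mul, ← hw, map_natCast]
    rw [hpw] at hq
    refine ⟨-(C w * incl (Rpi E) A n H * ∑ k ∈ Finset.Ioo 0 p, incl (Rpi E) A n G ^ (k - 1) *
      incl (Rpi E) A n H ^ (p - k - 1) * (p.choose k / p : ℕ)), ?_⟩
    apply cancel (basePi E)
    rw [mul_add, mul_add, unif_mul_delta, unif_mul_delta, unif_mul_delta, map_add, map_add, hq]
    ring
  have main : ∀ G ∈ extIdeal E A n,
      delta (basePi E) (basePi E).dvd_p n G ∈ extIdeal E A (n + 1) := by
    intro G hG
    refine Submodule.span_induction (p := fun G _ =>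
      delta (basePi E) (basePi E).dvd_p n G ∈ extIdeal E A (n + 1)) ?_ ?_ ?_ ?_ hG
    · rintro _ ⟨G, hG, rfl⟩
      exact delta_coeffMap_mem E A n hG
    · rw [h0]; exact zero_mem _
    · intro G H hG _ hdG hdH
      obtain ⟨t, ht⟩ := hadd G H
      rw [ht]
      exact add_mem (add_mem hdG hdH) (Ideal.mul_mem_right _ _ (hi G hG))
    · intro a G hG hdG
      rw [smul_eq_mul, hmul]
      exact add_mem (Ideal.mul_mem_left _ _ hdG) (Ideal.mul_mem_left _ _
        (Ideal.pow_mem_of_mem _ (hi G hG) p (Fact.out : p.Prime).pos))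
  exact main F hF

theorem jetIdeal_le_extIdeal : ∀ n,
    jetIdeal (basePi E) (basePi E).dvd_p (RingHom.ker (kappa E A)) n ≤ extIdeal E A n
  | 0 => ker_kappa_le E A
  | n + 1 => by
    have ih := jetIdeal_le_extIdeal n
    refine Ideal.span_le.2 ?_
    rintro _ (⟨F, hF, rfl⟩ | ⟨F, hF, rfl⟩)
    · exact (extIdeal_stable E A n (ih hF)).1
    · exact (extIdeal_stable E A n (ih hF)).2

/-- The projection `R_π[x, δ_p x, …, δ_p ⁿ x] → R_π ⊗ Aⁿ`. -/
def toTensor (n : ℕ) : JetPoly (Rpi E) A n →ₐ[Rpi E] Rpi E ⊗[Rp p] JetAlg (baseP p) A n :=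
  aeval fun s => (1 : Rpi E) ⊗ₜ[Rp p] JetAlg.mk (baseP p) A n (X s)

theorem extIdeal_le_ker (n : ℕ) : extIdeal E A n ≤ RingHom.ker (toTensor E A n) := by
  refine Ideal.map_le_iff_le_comap.2 fun F hF => ?_
  have h : (toTensor E A n).toRingHom.comp (coeffMap E A n) =
      (Algebra.TensorProduct.includeRight :
        JetAlg (baseP p) A n →ₐ[Rp p] Rpi E ⊗[Rp p] JetAlg (baseP p) A n).toRingHom.comp
        (JetAlg.mk (baseP p) A n).toRingHom := by
    ext s
    · change toTensor E A n (MvPolynomial.map _ (C s)) =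
        (1 : Rpi E) ⊗ₜ[Rp p] JetAlg.mk (baseP p) A n (C s)
      rw [MvPolynomial.map_C, algHom_C, algHom_C, Algebra.TensorProduct.algebraMap_apply,
        Algebra.algebraMap_self_apply, Algebra.algebraMap_eq_smul_one, TensorProduct.smul_tmul,
        Algebra.algebraMap_eq_smul_one]
    · simp [toTensor, coeffMap]
  have h2 := DFunLike.congr_fun h F
  have h3 : (JetAlg.mk (baseP p) A n).toRingHom F = 0 := (JetAlg.mk_eq_zero _ F).2 hF
  rw [RingHom.comp_apply, RingHom.comp_apply, h3, map_zero] at h2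
  exact h2

/-- The morphism of `π`-prolongation sequences from the `π`-jet algebras of `R_π ⊗ A` to
`R_π ⊗ Aⁿ`, where `Aⁿ` are the `p`-jet algebras of `A`: it sends `δ_π ⁱ b` to the `i`-th iterate of
`z ↦ (φ z - z ^ p) / π` on `b`. -/
def toPJetAlg (n : ℕ) :
    JetAlg (basePi E) (Rpi E ⊗[Rp p] A) n →ₐ[Rpi E] Rpi E ⊗[Rp p] JetAlg (baseP p) A n :=
  Ideal.Quotient.liftₐ _ ((toTensor E A n).comp (theta E A n)) fun F hF =>
    extIdeal_le_ker E A n (jetIdeal_le_extIdeal E A n (theta_mem E A n F hF))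

instance tensor_complete (D : Type) [CommRing D] [Algebra (Rp p) D] :
    IsAdicComplete (Ideal.span {(p : Rpi E ⊗[Rp p] PHat p D)}) (Rpi E ⊗[Rp p] PHat p D) :=
  isAdicComplete_tensor p

/-- The canonical map `𝒪(J_π ⁿ(X_{R_π})) → 𝒪(J_p ⁿ(X)) ⊗ R_π` for `X = Spec A`. -/
def toPJet (n : ℕ) :
    PHat p (JetAlg (basePi E) (Rpi E ⊗[Rp p] A) n) →+*
      Rpi E ⊗[Rp p] PHat p (JetAlg (baseP p) A n) :=
  PHat.lift p
    ((Algebra.TensorProduct.map (AlgHom.id (Rp p) (Rpi E))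
      (PHat.of p : JetAlg (baseP p) A n →ₐ[Rp p] PHat p (JetAlg (baseP p) A n))).toRingHom.comp
      (toPJetAlg E A n).toRingHom)

/-- The map `1 ⊗ Tr : 𝒪(J_p ⁿ(X)) ⊗ R_π → 𝒪(J_p ⁿ(X))` for `X = Spec A`. -/
def arithTrace (n : ℕ) :
    Rpi E ⊗[Rp p] PHat p (JetAlg (baseP p) A n) →ₗ[Rp p] PHat p (JetAlg (baseP p) A n) :=
  (TensorProduct.lid (Rp p) _).toLinearMap ∘ₗ
    LinearMap.rTensor _ (Algebra.trace (Rp p) (Rpi E))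

end Comparison

section Series

variable {p : ℕ} [Fact p.Prime] {σ : Type}

/-- A power series is restricted if its coefficients tend to `0` `p`-adically. -/
def IsRestrictedSeries (F : MvPowerSeries σ (Rp p)) : Prop :=
  ∀ m : ℕ, {α : σ →₀ ℕ | ¬ (p : Rp p) ^ m ∣ MvPowerSeries.coeff α F}.Finite

/-- The finite sum of the terms of a restricted series not divisible by `p ^ m`. -/
def truncSeries (F : MvPowerSeries σ (Rp p)) (hF : IsRestrictedSeries F) (m : ℕ) :
    MvPolynomial σ (Rp p) :=
  ∑ α ∈ (hF m).toFinset, monomial α (MvPowerSeries.coeff α F)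

/-- A restricted power series as an element of the `p`-adically completed polynomial ring. -/
def IsRestrictedSeries.toPHat {F : MvPowerSeries σ (Rp p)} (hF : IsRestrictedSeries F) :
    PHat p (MvPolynomial σ (Rp p)) :=
  AdicCompletion.mk _ _ ⟨truncSeries F hF, by
    classical
    intro m n hmn
    rw [smodEq_iff]
    have hd : ∀ α ∈ (hF n).toFinset \ (hF m).toFinset,
        (p : MvPolynomial σ (Rp p)) ^ m ∣ monomial α (MvPowerSeries.coeff α F) := by
      intro α hα
      rw [Finset.mem_sdiff, Set.Finite.mem_toFinset, Set.Finite.mem_toFinset, Set.mem_ofPred_eq,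
        Set.mem_ofPred_eq, not_not] at hα
      obtain ⟨t, ht⟩ := hα.2
      refine ⟨monomial α t, ?_⟩
      rw [ht, ← C_mul_monomial, map_pow, map_natCast]
    obtain ⟨z, hz⟩ := Finset.dvd_sum hd
    have hsub : (hF m).toFinset ⊆ (hF n).toFinset := by
      intro α hα
      rw [Set.Finite.mem_toFinset, Set.mem_ofPred_eq] at hα ⊢
      exact fun h => hα ((pow_dvd_pow _ hmn).trans h)
    refine ⟨-z, ?_⟩
    rw [smul_eq_mul, mul_neg, ← hz, truncSeries, truncSeries, ← Finset.sum_sdiff hsub]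
    ring⟩

/-- A series `∑ a_{α,β} x^α y^β`, where `x` are the variables with index `(0, j)` and `y` (standing
for `δ_p x, …, δ_p ʳ x`) are the others, is overconvergent in `y` with radius `≥ ρ = p ^ C` if
`v_p(a_{α,β}) ≥ C |β| - C'` for some constant `C' > 0`. Here `v_p(a) ≥ t` is expressed by `p ^ v ∣ a`
for some natural number `v ≥ t`. -/
def IsOverconvergentSeries {r d : ℕ} (ρ : ℝ) (F : MvPowerSeries (Fin (r + 1) × Fin d) (Rp p)) :
    Prop :=
  ∃ C' : ℝ, 0 < C' ∧ ∀ α : Fin (r + 1) × Fin d →₀ ℕ, ∃ v : ℕ,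
    Real.logb p ρ * ((α.sum fun s k => if s.1 = 0 then 0 else k : ℕ) : ℝ) - C' ≤ v ∧
      (p : Rp p) ^ v ∣ MvPowerSeries.coeff α F

end Series

section Schemes

open AlgebraicGeometry CategoryTheory

variable {R : Type} [CommRing R] {V : Scheme.{0}} (s : V ⟶ Spec (CommRingCat.of R))

/-- The sections of `𝒪_V` over `W`, as an algebra over the base ring through `V ⟶ Spec R`. -/
def Sec (_ : V ⟶ Spec (CommRingCat.of R)) (W : V.Opens) : Type := Γ(V, W)

instance (W : V.Opens) : CommRing (Sec s W) := inferInstanceAs (CommRing Γ(V, W))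

instance (W : V.Opens) : Algebra R (Sec s W) :=
  RingHom.toAlgebra
    ((Scheme.ΓSpecIso (CommRingCat.of R)).inv ≫ s.appTop ≫
      V.presheaf.map (homOfLE (le_top : W ≤ ⊤)).op).hom

/-- Restriction of sections. -/
def Sec.res {W W' : V.Opens} (h : W' ≤ W) : Sec s W →ₐ[R] Sec s W' where
  toRingHom := (V.presheaf.map (homOfLE h).op).hom
  commutes' r := by
    have h1 : V.presheaf.map (homOfLE (le_top : W ≤ ⊤)).op ≫ V.presheaf.map (homOfLE h).op =
        V.presheaf.map (homOfLE (le_top : W' ≤ ⊤)).op := by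
      rw [← Functor.map_comp]
      rfl
    change (((Scheme.ΓSpecIso (CommRingCat.of R)).inv ≫ s.appTop ≫
      V.presheaf.map (homOfLE (le_top : W ≤ ⊤)).op) ≫ V.presheaf.map (homOfLE h).op).hom r =
      ((Scheme.ΓSpecIso (CommRingCat.of R)).inv ≫ s.appTop ≫
        V.presheaf.map (homOfLE (le_top : W' ≤ ⊤)).op).hom r
    rw [Category.assoc, Category.assoc, h1]

end Schemes

section Jets

open AlgebraicGeometry CategoryTheory

variable {p : ℕ} [Fact p.Prime] {V : Scheme.{0}} (s : V ⟶ Spec (CommRingCat.of (Rp p)))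
  (E : EisensteinPoly p)

/-- The ring `𝒪(J_p ⁿ(V))` of global functions on the `p`-jet space: the `p`-jet space is glued from
`J_p ⁿ(W) = Spf` of the completed jet algebra of `𝒪(W)`, `W ⊆ V` affine open, so a global function
is a family of elements of these rings that is compatible with restriction. -/
def pJetFunctions (n : ℕ) :
    Subring ((W : V.affineOpens) → PHat p (JetAlg (baseP p) (Sec s W.1) n)) where
  carrier := {f | ∀ (W W' : V.affineOpens) (h : W'.1 ≤ W.1),
    PHat.map p (JetAlg.map (baseP p) (Sec.res s h) n).toRingHom (f W) = f W'}
  zero_mem' W W' h := map_zero _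
  one_mem' W W' h := map_one _
  add_mem' hf hg W W' h := by rw [Pi.add_apply, map_add, hf W W' h, hg W W' h]; rfl
  mul_mem' hf hg W W' h := by rw [Pi.mul_apply, map_mul, hf W W' h, hg W W' h]; rfl
  neg_mem' hf W W' h := by rw [Pi.neg_apply, map_neg, hf W W' h]; rfl

/-- The ring `𝒪(J_π ⁿ(V_{R_π}))` of global functions on the `π`-jet space of `V_{R_π}`, which is
covered by the `π`-jet spaces of the affine open subschemes `W_{R_π} = Spec (R_π ⊗ 𝒪(W))`,
`W ⊆ V` affine open. -/
def piJetFunctions (n : ℕ) :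
    Subring ((W : V.affineOpens) → PHat p (JetAlg (basePi E) (Rpi E ⊗[Rp p] Sec s W.1) n)) where
  carrier := {g | ∀ (W W' : V.affineOpens) (h : W'.1 ≤ W.1),
    PHat.map p (JetAlg.map (basePi E)
      (Algebra.TensorProduct.map (AlgHom.id (Rpi E) (Rpi E)) (Sec.res s h)) n).toRingHom (g W) =
      g W'}
  zero_mem' W W' h := map_zero _
  one_mem' W W' h := map_one _
  add_mem' hf hg W W' h := by rw [Pi.add_apply, map_add, hf W W' h, hg W W' h]; rfl
  mul_mem' hf hg W W' h := by rw [Pi.mul_apply, map_mul, hf W W' h, hg W W' h]; rfl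
  neg_mem' hf W W' h := by rw [Pi.neg_apply, map_neg, hf W W' h]; rfl

/-- `f` is `δ_π`-overconvergent: some multiple `p ^ ν f` is in the image of the trace map
`𝒪(J_π ⁿ(V_{R_π})) → 𝒪(J_p ⁿ(V)) ⊗ R_π → 𝒪(J_p ⁿ(V))`, or (equivalently, when `ℚ_p(π)/ℚ_p` is Galois)
some multiple `p ^ ν f` is in the image of `𝒪(J_π ⁿ(V_{R_π})) → 𝒪(J_p ⁿ(V)) ⊗ R_π`. -/
def IsDeltaPiOverconvergent {n : ℕ} (f : pJetFunctions s n) : Prop :=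
  (∃ (ν : ℕ) (g : piJetFunctions s E n), ∀ W : V.affineOpens,
    arithTrace E (Sec s W.1) n (toPJet E (Sec s W.1) n (g.1 W)) = (p : PHat p _) ^ ν * f.1 W) ∨
  (∃ (ν : ℕ) (g : piJetFunctions s E n), ∀ W : V.affineOpens,
    toPJet E (Sec s W.1) n (g.1 W) = 1 ⊗ₜ[Rp p] ((p : PHat p _) ^ ν * f.1 W))

/-- The map `R_p[x, δ_p x, …, δ_p ⁿ x]^ = 𝒪(J_p ⁿ(𝔸^d)) → 𝒪(J_p ⁿ(Spec A))` induced by the morphism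
`Spec A → 𝔸^d` with coordinates `x`; it sends `δ_p ⁱ x_j` to `δ_p ⁱ (x j)`. -/
def affineJetMap {A : Type} [CommRing A] [Algebra (Rp p) A] {d : ℕ} (x : Fin d → A) (n : ℕ) :
    PHat p (MvPolynomial (Fin (n + 1) × Fin d) (Rp p)) →+* PHat p (JetAlg (baseP p) A n) :=
  PHat.map p (aeval fun t : Fin (n + 1) × Fin d =>
    JetAlg.mk (baseP p) A n (X (t.1, x t.2))).toRingHom

/-- The coordinate functions on `W` of a morphism `W ⟶ 𝔸^d`. -/
def embCoord (W : V.Opens) {d : ℕ}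
    (j : (W : Scheme) ⟶ 𝔸(Fin d; Spec (CommRingCat.of (Rp p)))) (i : Fin d) : Sec s W :=
  W.topIso.hom (j.appTop (AffineSpace.coord (Spec (CommRingCat.of (Rp p))) i))

/-- `f` is `δ_p`-overconvergent with radius `≥ ρ`: for each affine open `W ⊆ V` and each closed
embedding of `W` in an affine space over `R_p`, the image of `f` in `𝒪(J_p ⁿ(W))` is the image of a
restricted power series that is overconvergent in `δ_p x, …, δ_p ⁿ x` with radius `≥ ρ`. -/
def IsDeltaPOverconvergent {n : ℕ} (ρ : ℝ) (f : pJetFunctions s n) : Prop :=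
  ∀ (W : V.affineOpens) (d : ℕ)
    (j : (W.1 : Scheme) ⟶ 𝔸(Fin d; Spec (CommRingCat.of (Rp p)))),
    IsClosedImmersion j →
    j ≫ (𝔸(Fin d; Spec (CommRingCat.of (Rp p))) ↘ Spec (CommRingCat.of (Rp p))) = W.1.ι ≫ s →
    ∃ (F : MvPowerSeries (Fin (n + 1) × Fin d) (Rp p)) (hF : IsRestrictedSeries F),
      IsOverconvergentSeries ρ F ∧
        affineJetMap (embCoord s W.1 j) n hF.toPHat = f.1 W

end Jets

end ArithJet

end

set_option linter.unusedSectionVars false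

noncomputable section

namespace ArithJet

open MvPolynomial TensorProduct

/-! ### `p`-adic completions: elements as series, and the kernel of a completed surjection. -/

section CompletionSeries

variable (p : ℕ) {A A' : Type} [CommRing A] [CommRing A']

/-! The point is that `δ_π` becomes divisible by a high power of `π` when it is written through
`δ_p`. For a coordinate `x`, `δ_π x = (p/π) δ_p x`, and `p` is divisible by `π ^ e`, so `δ_π x` is
`π ^ (e-1)` times a polynomial of degree 1. Since `φ` fixes `π`, `δ_π (π ^ (k+1) Q) = π ^ k (φ Q - π
^ ((k+1)(p-1)) Q ^ p)`: each further `δ_π` costs one factor `π` and multiplies the degree by at most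
`p`. Hence for `1 ≤ i ≤ r ≤ e-1` the element `δ_π ⁱ x` is `π ^ (e-i) Q` with `deg Q ≤ p ^ (i-1)` and
`e-i ≥ 1` (`exists_iterDelta_sub_ren_mem`). So at least one `π` is available for every `p ^ (r-1)`
degrees in the derivatives, a condition stable under sums and products (`growthSubalgebra`).

A function on the `π`-jet space of an affine `W` is a `p`-adic series of polynomials in the `δ_π ⁱ
x_j`; its image has coefficients of `π`-adic valuation at least `b / p ^ (r-1)` on monomials of
derivative degree `b`. An `R_p`-linear functional on `R_π`, applied to coefficients, turns `π ^ m`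
into `p ^ ⌊m/e⌋` (`pow_dvd_functional`), giving slope `1 / (p ^ (r-1) e)`. Both forms of
`δ_π`-overconvergence are covered: the trace, or a functional with value `1` at `1`.

This yields an overconvergent series `F'` over `p ^ ν f`. To divide by `p ^ ν`, take any lift `F₀`
of `f`. By Artin–Rees (`PHat.exists_eq_add_of_map_eq_zero`), `F' - p ^ ν F₀ = P + p ^ ν y` with `P`
a polynomial and `y` in the kernel of the completed map. Then `F₀ + y` lifts `f`, and `p ^ ν (F₀ +
y) = F' - P` is overconvergent, since a polynomial only affects the constant `C'`. -/

theorem quotient_mk_eq_iff (n : ℕ) (a b : A) :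
    Ideal.Quotient.mk (Ideal.span {(p : A)} ^ n) a = Ideal.Quotient.mk _ b ↔
      (p : A) ^ n ∣ a - b := by
  rw [Ideal.Quotient.eq, Ideal.span_singleton_pow, Ideal.mem_span_singleton]

theorem cauchy_partialSums (z : ℕ → A) {m n : ℕ} (h : m ≤ n) :
    (p : A) ^ m ∣ ∑ k ∈ Finset.range m, (p : A) ^ k * z k -
      ∑ k ∈ Finset.range n, (p : A) ^ k * z k := by
  obtain ⟨l, rfl⟩ := Nat.exists_eq_add_of_le h
  rw [Finset.sum_range_add, sub_add_cancel_left]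
  exact (dvd_neg.2 (Finset.dvd_sum fun k _ => by rw [pow_add, mul_assoc]; exact dvd_mul_right _ _))

/-- The element `∑ pᵏ zₖ` of the `p`-adic completion. -/
def PHat.series (z : ℕ → A) : PHat p A :=
  AdicCompletion.mk _ _ ⟨fun n => ∑ k ∈ Finset.range n, (p : A) ^ k * z k, by
    intro m n hmn
    rw [smodEq_iff]
    obtain ⟨t, ht⟩ := cauchy_partialSums p z hmn
    exact ⟨t, ht⟩⟩

theorem PHat.evalₐ_series (z : ℕ → A) (n : ℕ) :
    AdicCompletion.evalₐ (Ideal.span {(p : A)}) n (PHat.series p z) =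
      Ideal.Quotient.mk _ (∑ k ∈ Finset.range n, (p : A) ^ k * z k) :=
  AdicCompletion.evalₐ_mk _ _ _

theorem PHat.evalₐ_algebraMap (a : A) (n : ℕ) :
    AdicCompletion.evalₐ (Ideal.span {(p : A)}) n (algebraMap A (PHat p A) a) =
      Ideal.Quotient.mk _ a :=
  AdicCompletion.evalₐ_of _ _ _

theorem PHat.exists_eq_series (x : PHat p A) : ∃ z : ℕ → A, x = PHat.series p z := by
  obtain ⟨c, rfl⟩ := AdicCompletion.mk_surjective _ _ x
  have h : ∀ n, ∃ t : A, c (n + 1) - c n = (p : A) ^ n * t := fun n =>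
    (smodEq_iff p n _ _).1 ((c.2 n.le_succ).symm)
  choose t ht using h
  -- The differences telescope; `c 0` is absorbed into the term of index 0. The empty partial sum
  -- does not contain it, which is harmless modulo `p ^ 0`.
  refine ⟨fun k => t k + if k = 0 then c 0 else 0, AdicCompletion.ext_evalₐ fun n => ?_⟩
  rw [PHat.evalₐ_series, AdicCompletion.evalₐ_mk]
  cases n with
  | zero => rw [quotient_mk_eq_iff, pow_zero]; exact one_dvd _
  | succ n =>
    congr 1
    induction n with
    | zero => simp [← sub_eq_iff_eq_add, ht 0]
    | succ n ih => rw [Finset.sum_range_succ, ← ih, ← sub_eq_iff_eq_add', ht]; simp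

/-- Splitting off a finite head leaves a multiple of `p ^ n`, so identities between series can be
tested on finitely many terms at a time. -/
theorem PHat.series_eq (z : ℕ → A) (n : ℕ) :
    PHat.series p z = ∑ k ∈ Finset.range n, (p : PHat p A) ^ k * algebraMap A (PHat p A) (z k) +
      (p : PHat p A) ^ n * PHat.series p (fun k => z (n + k)) := by
  refine AdicCompletion.ext_evalₐ fun m => ?_
  simp only [map_add, map_sum, map_mul, map_pow, map_natCast, PHat.evalₐ_series,
    PHat.evalₐ_algebraMap]
  simp only [← map_natCast (Ideal.Quotient.mk (Ideal.span {(p : A)} ^ m)), ← map_pow, ← map_mul,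
    ← map_sum, ← map_add]
  rw [quotient_mk_eq_iff]
  convert cauchy_partialSums p z (Nat.le_add_left m n) using 2
  rw [Finset.sum_range_add, Finset.mul_sum]
  simp only [pow_add, mul_assoc]

theorem PHat.eq_of_forall_dvd {x y : PHat p A} (h : ∀ n, (p : PHat p A) ^ n ∣ x - y) : x = y := by
  rw [← sub_eq_zero]
  refine (PHat.complete p A).toIsHausdorff.haus _ fun n => ?_
  obtain ⟨t, ht⟩ := h n
  exact (smodEq_iff p n _ _).2 ⟨t, by rw [sub_zero, ht]; rfl⟩

/-- An additive map between completions is determined on series by its values on the terms. -/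
theorem PHat.addHom_series (M : PHat p A →+ PHat p A') (z : ℕ → A) (w : ℕ → A')
    (h : ∀ k, M (algebraMap A _ (z k)) = algebraMap A' _ (w k)) :
    M (PHat.series p z) = PHat.series p w := by
  -- Multiplication by `p ^ n` is repeated addition, so an additive map is automatically
  -- `p`-adically continuous. No multiplicativity is needed, which matters for the trace and other
  -- functionals.
  have hM : ∀ n x, M ((p : PHat p A) ^ n * x) = (p : PHat p A') ^ n * M x := fun n x => by
    rw [← Nat.cast_pow, ← Nat.cast_pow, ← nsmul_eq_mul, ← nsmul_eq_mul, map_nsmul]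
  refine PHat.eq_of_forall_dvd p fun n => ?_
  rw [PHat.series_eq p z n, PHat.series_eq p w n, map_add, map_sum, hM]
  simp only [hM, h]
  rw [add_sub_add_left_eq_sub, ← mul_sub]
  exact dvd_mul_right _ _

theorem PHat.map_algebraMap (u : A →+* A') (a : A) :
    PHat.map p u (algebraMap A _ a) = algebraMap A' _ (u a) := by
  refine AdicCompletion.ext_evalₐ fun n => ?_
  rw [PHat.map, AdicCompletion.evalₐ_liftRingHom, PHat.evalₐ_algebraMap, modPow,
    RingHom.comp_apply, RingHom.coe_coe, PHat.evalₐ_algebraMap, Ideal.quotientMap_mk]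

theorem PHat.map_series (u : A →+* A') (z : ℕ → A) :
    PHat.map p u (PHat.series p z) = PHat.series p (fun k => u (z k)) :=
  PHat.addHom_series p (PHat.map p u).toAddMonoidHom z _ fun k => PHat.map_algebraMap p u (z k)

theorem PHat.map_surjective {u : A →+* A'} (hu : Function.Surjective u) :
    Function.Surjective (PHat.map p u) := by
  intro x
  obtain ⟨w, rfl⟩ := PHat.exists_eq_series p x
  choose z hz using fun k => hu (w k)
  exact ⟨PHat.series p z, by rw [PHat.map_series]; simp only [hz]⟩

theorem PHat.lift_algebraMap [IsAdicComplete (Ideal.span {(p : A')}) A'] (u : A →+* A') (a : A) :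
    PHat.lift p u (algebraMap A _ a) = u a := by
  have : IsHausdorff (Ideal.span {(p : A')}) A' := inferInstance
  rw [← sub_eq_zero]
  refine this.haus _ fun n => ?_
  have h := IsAdicComplete.mk_liftRingHom (Ideal.span {(p : A')}) (modPow p u)
    (fun h => modPow_compat p u h) (n := n) (algebraMap A _ a)
  rw [modPow, RingHom.comp_apply, RingHom.coe_coe, PHat.evalₐ_algebraMap,
    Ideal.quotientMap_mk] at h
  rw [SModEq.zero, Ideal.smul_top_eq_map, Algebra.algebraMap_self, Ideal.map_id]
  exact Ideal.Quotient.eq.1 h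

/-- For a surjection `u` from a noetherian ring, the kernel of the completion of `u` is the sum of
the kernel of `u` and of `p ^ ν` times itself (a consequence of the Artin–Rees lemma). -/
theorem PHat.exists_eq_add_of_map_eq_zero [IsNoetherianRing A] {u : A →+* A'}
    (hu : Function.Surjective u) {x : PHat p A} (hx : PHat.map p u x = 0) (ν : ℕ) :
    ∃ (a : A) (y : PHat p A), u a = 0 ∧ PHat.map p u y = 0 ∧
      x = algebraMap A _ a + (p : PHat p A) ^ ν * y := by
  obtain ⟨z, rfl⟩ := PHat.exists_eq_series p x
  obtain ⟨c, hc⟩ := Ideal.exists_pow_inf_eq_pow_smul (Ideal.span {(p : A)})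
    (RingHom.ker u : Submodule A A)
  -- Artin–Rees with constant `c`: an element of the kernel divisible by `p ^ (n + c)` is `p ^ n`
  -- times an element of the kernel.
  have hAR : ∀ (n : ℕ) (a b : A), u (a - b) = 0 → (p : A) ^ (n + c) ∣ a - b →
      ∃ t, u t = 0 ∧ a = b + (p : A) ^ n * t := by
    intro n a b h1 h2
    have hmem : a - b ∈ (Ideal.span {(p : A)} ^ n) •
        ((Ideal.span {(p : A)} ^ c) • ⊤ ⊓ (RingHom.ker u : Submodule A A)) := by
      have := hc (n + c) (Nat.le_add_left _ _)
      rw [Nat.add_sub_cancel] at this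
      rw [← this]
      refine ⟨?_, h1⟩
      rw [smul_eq_mul, Ideal.mul_top, Ideal.span_singleton_pow]
      exact Ideal.mem_span_singleton.2 h2
    rw [Ideal.span_singleton_pow, Submodule.ideal_span_singleton_smul,
      Submodule.mem_smul_pointwise_iff_exists] at hmem
    obtain ⟨t, ht, h⟩ := hmem
    exact ⟨t, ht.2, by rw [← sub_eq_iff_eq_add', ← h, smul_eq_mul]⟩
  -- The image of the `n`-th partial sum is divisible by `p ^ n`; by surjectivity the quotient
  -- lifts, and subtracting that lift corrects the partial sum to an element of the kernel.
  have hj : ∀ n, ∃ j : A, u j = 0 ∧ (p : A) ^ n ∣ ∑ k ∈ Finset.range n, (p : A) ^ k * z k - j := by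
    intro n
    have h := congrArg (AdicCompletion.evalₐ (Ideal.span {(p : A')}) n) hx
    rw [PHat.map_series, PHat.evalₐ_series, map_zero, ← map_zero (Ideal.Quotient.mk _),
      quotient_mk_eq_iff, sub_zero] at h
    obtain ⟨t, ht⟩ := h
    obtain ⟨t, rfl⟩ := hu t
    refine ⟨∑ k ∈ Finset.range n, (p : A) ^ k * z k - (p : A) ^ n * t, ?_, ?_⟩
    · simp only [map_sub, map_sum, map_mul, map_pow, map_natCast, ht, sub_self]
    · rw [sub_sub_cancel]; exact dvd_mul_right _ _
  choose j hj0 hjd using hj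
  -- Starting at index `ν + c` leaves a factor `p ^ (m + ν)` in each increment: `c` is lost to
  -- Artin–Rees, and `p ^ ν` is the common factor to extract.
  have hstep : ∀ m, ∃ t, u t = 0 ∧ j (m + ν + c + 1) = j (m + ν + c) + (p : A) ^ (m + ν) * t := by
    intro m
    refine hAR _ _ _ (by rw [map_sub, hj0, hj0, sub_zero]) ?_
    have h1 := (pow_dvd_pow _ (Nat.le_succ (m + ν + c))).trans (hjd (m + ν + c + 1))
    have h3 := dvd_sub (dvd_sub (hjd (m + ν + c)) h1)
      (cauchy_partialSums p z (Nat.le_succ (m + ν + c)))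
    convert h3 using 1
    ring
  choose t ht0 ht using hstep
  have hsum : ∀ m, j (m + ν + c) = j (0 + ν + c) +
      (p : A) ^ ν * ∑ k ∈ Finset.range m, (p : A) ^ k * t k := by
    intro m
    induction m with
    | zero => simp
    | succ m ih =>
      have h1 : m + 1 + ν + c = m + ν + c + 1 := by ring
      rw [h1, ht, ih, Finset.sum_range_succ]
      ring
  refine ⟨j (0 + ν + c), PHat.series p t, hj0 _, ?_, ?_⟩
  · rw [PHat.map_series]
    simp only [ht0]
    refine AdicCompletion.ext_evalₐ fun n => ?_
    rw [PHat.evalₐ_series]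
    simp
  · refine AdicCompletion.ext_evalₐ fun m => ?_
    rw [map_add, map_mul, map_pow, map_natCast, PHat.evalₐ_series, PHat.evalₐ_series,
      PHat.evalₐ_algebraMap, ← map_natCast (Ideal.Quotient.mk _), ← map_pow, ← map_mul, ← map_add,
      quotient_mk_eq_iff, ← hsum]
    have hle : m ≤ m + ν + c := by omega
    have h := dvd_add (cauchy_partialSums p z hle) ((pow_dvd_pow _ hle).trans (hjd (m + ν + c)))
    rwa [sub_add_sub_cancel] at h

end CompletionSeries

/-! ### Restricted power series as elements of the completed polynomial ring. -/

section RestrictedSeries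

variable {p : ℕ} [Fact p.Prime] {σ : Type}

theorem Rp.eq_zero_of_forall_dvd {a : Rp p} (h : ∀ n, (p : Rp p) ^ n ∣ a) : a = 0 := by
  have : IsHausdorff (Ideal.span {(p : Rp p)}) (Rp p) := inferInstance
  refine this.haus _ fun n => ?_
  obtain ⟨t, ht⟩ := h n
  exact (smodEq_iff p n _ _).2 ⟨t, by rw [sub_zero, ht]; rfl⟩

theorem pow_dvd_iff_coeff (m : ℕ) (P : MvPolynomial σ (Rp p)) :
    (p : MvPolynomial σ (Rp p)) ^ m ∣ P ↔ ∀ α, (p : Rp p) ^ m ∣ coeff α P := by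
  rw [← C_dvd_iff_dvd_coeff, map_pow, map_natCast]

theorem dvd_coeff_truncSeries_sub {F : MvPowerSeries σ (Rp p)} (hF : IsRestrictedSeries F) (m : ℕ)
    (α : σ →₀ ℕ) : (p : Rp p) ^ m ∣ coeff α (truncSeries F hF m) - MvPowerSeries.coeff α F := by
  classical
  simp only [truncSeries, coeff_sum, coeff_monomial]
  rw [Finset.sum_ite_eq' (hF m).toFinset α]
  split_ifs with h
  · simp
  · rw [zero_sub, dvd_neg]
    simpa using h

theorem IsRestrictedSeries.evalₐ_toPHat {F : MvPowerSeries σ (Rp p)} (hF : IsRestrictedSeries F)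
    (m : ℕ) : AdicCompletion.evalₐ (Ideal.span {(p : MvPolynomial σ (Rp p))}) m hF.toPHat =
      Ideal.Quotient.mk _ (truncSeries F hF m) :=
  AdicCompletion.evalₐ_mk _ _ _

/-- The coefficients of `F`, compared with those of an approximation of `F` modulo `p ^ m`. -/
theorem IsRestrictedSeries.dvd_coeff_sub {F : MvPowerSeries σ (Rp p)} (hF : IsRestrictedSeries F)
    {m : ℕ} {P : MvPolynomial σ (Rp p)}
    (h : AdicCompletion.evalₐ (Ideal.span {(p : MvPolynomial σ (Rp p))}) m hF.toPHat =
      Ideal.Quotient.mk _ P) (α : σ →₀ ℕ) :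
    (p : Rp p) ^ m ∣ MvPowerSeries.coeff α F - coeff α P := by
  rw [IsRestrictedSeries.evalₐ_toPHat, quotient_mk_eq_iff,
    pow_dvd_iff_coeff] at h
  have h2 := dvd_sub (h α) (dvd_coeff_truncSeries_sub hF m α)
  rwa [coeff_sub, sub_sub_sub_cancel_left] at h2

/-- Every element of the completed polynomial ring is a restricted power series. -/
theorem exists_restrictedSeries (x : PHat p (MvPolynomial σ (Rp p))) :
    ∃ (F : MvPowerSeries σ (Rp p)) (hF : IsRestrictedSeries F), hF.toPHat = x := by
  classical
  obtain ⟨z, rfl⟩ := PHat.exists_eq_series p x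
  -- The coefficients of the series are the limits, in the complete ring `R_p`, of the coefficients
  -- of the partial sums.
  have hpre : IsPrecomplete (Ideal.span {(p : Rp p)}) (Rp p) := inferInstance
  have hL : ∀ α : σ →₀ ℕ, ∃ L : Rp p, ∀ m,
      (p : Rp p) ^ m ∣ ∑ k ∈ Finset.range m, (p : Rp p) ^ k * coeff α (z k) - L := by
    intro α
    obtain ⟨L, hL⟩ := hpre.prec
      (f := fun m => ∑ k ∈ Finset.range m, (p : Rp p) ^ k * coeff α (z k)) (by
        intro m n hmn
        obtain ⟨t, ht⟩ := cauchy_partialSums p (fun k => coeff α (z k)) hmn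
        exact (smodEq_iff p m _ _).2 ⟨t, ht⟩)
    refine ⟨L, fun m => ?_⟩
    obtain ⟨t, ht⟩ := (smodEq_iff p m _ _).1 (hL m)
    exact ⟨t, ht⟩
  choose L hL using hL
  have hco : ∀ α m, coeff α (∑ k ∈ Finset.range m, (p : MvPolynomial σ (Rp p)) ^ k * z k) =
      ∑ k ∈ Finset.range m, (p : Rp p) ^ k * coeff α (z k) := by
    intro α m
    rw [coeff_sum]
    refine Finset.sum_congr rfl fun k _ => ?_
    rw [← map_natCast C, ← map_pow, coeff_C_mul]
  obtain ⟨F, hFL⟩ : ∃ F : MvPowerSeries σ (Rp p), ∀ α, MvPowerSeries.coeff α F = L α :=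
    ⟨L, fun _ => rfl⟩
  have hF : IsRestrictedSeries F := by
    intro m
    -- A coefficient not divisible by `p ^ m` is already nonzero in the `m`-th partial sum, whose
    -- support is finite.
    refine (Finset.finite_toSet
      (∑ k ∈ Finset.range m, (p : MvPolynomial σ (Rp p)) ^ k * z k).support).subset ?_
    intro α hα
    rw [Finset.mem_coe, mem_support_iff, hco]
    intro h0
    have := hL α m
    rw [h0, zero_sub, dvd_neg] at this
    exact hα (by rwa [hFL])
  refine ⟨F, hF, AdicCompletion.ext_evalₐ fun m => ?_⟩
  rw [PHat.evalₐ_series, IsRestrictedSeries.evalₐ_toPHat, quotient_mk_eq_iff,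
    pow_dvd_iff_coeff]
  intro α
  rw [coeff_sub, hco]
  have h := dvd_sub (dvd_coeff_truncSeries_sub hF m α) (hL α m)
  rwa [hFL, sub_sub_sub_cancel_right] at h

end RestrictedSeries

/-! ### Congruences, changes of variables and degrees under `δ` and `φ`. -/

namespace JetPoly

variable {p : ℕ} [Fact p.Prime] {R σ τ : Type} [CommRing R] (B : FrobBase p R)

/-- The mixed binomial terms are divisible by `p`, hence by `unif`, and by `G`. Keeping the factor
`G` makes the correction vanish modulo any ideal containing the image of `G`. -/
theorem delta_add {c : R} (hc : B.unif ∣ c) (n : ℕ) (G H : JetPoly R σ n) :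
    ∃ t, delta B hc n (G + H) = delta B hc n G + delta B hc n H + incl R σ n G * t := by
  obtain ⟨w, hw⟩ := B.dvd_p
  have hq := add_pow_prime_eq (Fact.out : p.Prime) (incl R σ n G) (incl R σ n H)
  have hpw : (p : JetPoly R σ (n + 1)) = C B.unif * C w := by
    rw [← C_mul, ← hw, map_natCast]
  rw [hpw] at hq
  refine ⟨-(C w * incl R σ n H * ∑ k ∈ Finset.Ioo 0 p, incl R σ n G ^ (k - 1) *
    incl R σ n H ^ (p - k - 1) * (p.choose k / p : ℕ)), ?_⟩
  apply cancel B
  rw [mul_add, mul_add, unif_mul_delta, unif_mul_delta, unif_mul_delta, map_add, map_add, hq]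
  ring

/-- `δ` preserves congruences modulo a pair of ideals stable under `δ`. -/
theorem delta_sub_mem {c : R} (hc : B.unif ∣ c) {n : ℕ} {I : Ideal (JetPoly R σ n)}
    {I' : Ideal (JetPoly R σ (n + 1))} (hi : ∀ F ∈ I, incl R σ n F ∈ I')
    (hd : ∀ F ∈ I, delta B hc n F ∈ I') {G H : JetPoly R σ n} (h : G - H ∈ I) :
    delta B hc n G - delta B hc n H ∈ I' := by
  obtain ⟨t, ht⟩ := delta_add B hc n (G - H) H
  rw [sub_add_cancel] at ht
  have h' : delta B hc n G - delta B hc n H = delta B hc n (G - H) + incl R σ n (G - H) * t := by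
    rw [ht]; ring
  rw [h']
  exact add_mem (hd _ h) (Ideal.mul_mem_right _ _ (hi _ h))

/-- Used with `a = 1` over `R_p`, and with `c = p`, `a = p/π` over `R_π`. The second case is the
source of all divisibility by `π`. -/
theorem delta_X {c a : R} (hc : B.unif ∣ c) (ha : c = B.unif * a) (n : ℕ)
    (s : Fin (n + 1) × σ) : delta B hc n (X s) = C a * X (s.1.succ, s.2) := by
  apply cancel B
  rw [unif_mul_delta, ← mul_assoc, ← C_mul, ← ha]
  simp [Phi, incl]

/-- The map of jet polynomials induced by a map of variables. -/
def ren (R : Type) [CommRing R] (v : σ → τ) (n : ℕ) : JetPoly R σ n →ₐ[R] JetPoly R τ n :=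
  rename fun s => (s.1, v s.2)

theorem ren_X (v : σ → τ) (n : ℕ) (s : Fin (n + 1) × σ) :
    ren R v n (X s) = X (s.1, v s.2) := rename_X _ _

theorem ren_incl (v : σ → τ) (n : ℕ) (F : JetPoly R σ n) :
    ren R v (n + 1) (incl R σ n F) = incl R τ n (ren R v n F) := by
  simp only [ren, incl, rename_rename]
  rfl

theorem ren_Phi (c : R) (v : σ → τ) (n : ℕ) (F : JetPoly R σ n) :
    ren R v (n + 1) (Phi B c σ n F) = Phi B c τ n (ren R v n F) := by
  induction F using MvPolynomial.induction_on with
  | C a => simp [Phi, ren]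
  | add F G hF hG => simp only [map_add, hF, hG]
  | mul_X F s hF =>
    rw [map_mul, map_mul, map_mul, map_mul, hF]
    congr 1
    simp [Phi, ren]

theorem ren_delta {c : R} (hc : B.unif ∣ c) (v : σ → τ) (n : ℕ) (F : JetPoly R σ n) :
    ren R v (n + 1) (delta B hc n F) = delta B hc n (ren R v n F) :=
  delta_comm B hc hc n _ _ (ren_incl v n) (ren_Phi B c v n) F

/-- Each variable goes to a polynomial of degree at most `p`, and coefficients go to constants. -/
theorem totalDegree_Phi_le (c : R) (n : ℕ) (F : JetPoly R σ n) :
    (Phi B c σ n F).totalDegree ≤ p * F.totalDegree := by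
  cases subsingleton_or_nontrivial R
  · rw [Subsingleton.elim (Phi B c σ n F) 0, totalDegree_zero]
    exact Nat.zero_le _
  have hp := (Fact.out : p.Prime).one_le
  have hX : ∀ s : Fin (n + 1) × σ,
      (X (s.1.castSucc, s.2) ^ p + C c * X (s.1.succ, s.2) :
        JetPoly R σ (n + 1)).totalDegree ≤ p := by
    intro s
    refine (totalDegree_add _ _).trans (max_le ?_ ?_)
    · rw [totalDegree_X_pow]
    · refine (totalDegree_mul _ _).trans ?_
      rwa [totalDegree_C, totalDegree_X, zero_add]
  conv_lhs => rw [F.as_sum, map_sum]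
  refine totalDegree_finsetSum_le fun α hα => ?_
  rw [Phi, eval₂Hom_monomial]
  refine (totalDegree_mul _ _).trans ?_
  rw [RingHom.comp_apply, totalDegree_C, zero_add]
  refine (totalDegree_finsetProd _ _).trans
    (le_trans ?_ (Nat.mul_le_mul_left p (le_totalDegree hα)))
  rw [Finsupp.sum, Finset.mul_sum]
  refine Finset.sum_le_sum fun s _ => (totalDegree_pow _ _).trans ?_
  rw [mul_comm]
  exact Nat.mul_le_mul_right _ (hX s)

end JetPoly

open JetPoly

/-! ### Generators of the jet algebras. -/

section Generation

variable {p : ℕ} [Fact p.Prime] {R σ : Type} [CommRing R] (B : FrobBase p R)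
  {A : Type} [CommRing A] [Algebra R A]

/-- Reduces the tautological presentation, with one variable per element of `A`, to the chosen
generators. A polynomial expression for `a` is differentiated repeatedly, since `δ` respects
congruences modulo the jet ideals. -/
theorem exists_sub_ren_mem_jetIdeal {y : σ → A}
    (hy : Function.Surjective (aeval y : MvPolynomial σ R →ₐ[R] A)) (a : A) :
    ∀ (n : ℕ) (i : Fin (n + 1)), ∃ G : JetPoly R σ n,
      X (i, a) - ren R y n G ∈ jetIdeal B (dvd_refl B.unif) (relIdeal R A) n
  | 0, i => by
    obtain ⟨P, rfl⟩ := hy a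
    refine ⟨rename (fun s => (i, s)) P, ?_⟩
    change _ ∈ relIdeal R A
    rw [relIdeal, RingHom.mem_ker, map_sub, aeval_X, ren, rename_rename, aeval_rename, sub_eq_zero]
    rfl
  | n + 1, i => by
    induction i using Fin.lastCases with
    | cast i =>
      obtain ⟨G, hG⟩ := exists_sub_ren_mem_jetIdeal hy a n i
      refine ⟨incl R σ n G, Ideal.subset_span (Or.inl ⟨_, hG, ?_⟩)⟩
      rw [map_sub, ren_incl, incl, rename_X]
    | last =>
      obtain ⟨G, hG⟩ := exists_sub_ren_mem_jetIdeal hy a n (Fin.last n)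
      refine ⟨delta B (dvd_refl _) n G, ?_⟩
      have h := delta_sub_mem B (dvd_refl _)
        (I' := jetIdeal B (dvd_refl B.unif) (relIdeal R A) (n + 1))
        (fun F hF => Ideal.subset_span (Or.inl ⟨F, hF, rfl⟩))
        (fun F hF => Ideal.subset_span (Or.inr ⟨F, hF, rfl⟩)) hG
      rwa [delta_X B (dvd_refl _) (mul_one _).symm, C_1, one_mul, ← ren_delta] at h

/-- If the `y_j` generate `A`, then the `δⁱ y_j` generate the jet algebras. -/
theorem aeval_jet_surjective {y : σ → A}
    (hy : Function.Surjective (aeval y : MvPolynomial σ R →ₐ[R] A)) (n : ℕ) :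
    Function.Surjective (aeval fun t : Fin (n + 1) × σ => JetAlg.mk B A n (X (t.1, y t.2)) :
      JetPoly R σ n →ₐ[R] JetAlg B A n) := by
  set u : JetPoly R σ n →ₐ[R] JetAlg B A n :=
    aeval fun t : Fin (n + 1) × σ => JetAlg.mk B A n (X (t.1, y t.2)) with hu
  have hu' : ∀ G, u G = JetAlg.mk B A n (ren R y n G) := by
    intro G
    rw [← AlgHom.comp_apply]
    congr 1
    ext t
    simp [hu, ren_X]
  have hX : ∀ s : Fin (n + 1) × A, JetAlg.mk B A n (X s) ∈ u.range := by
    rintro ⟨i, a⟩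
    obtain ⟨G, hG⟩ := exists_sub_ren_mem_jetIdeal B hy a n i
    refine ⟨G, ?_⟩
    rw [← JetAlg.mk_eq_zero, map_sub, sub_eq_zero] at hG
    exact (hu' G).trans hG.symm
  intro x
  obtain ⟨F, rfl⟩ := Ideal.Quotient.mk_surjective x
  change ∃ a, u a = JetAlg.mk B A n F
  change JetAlg.mk B A n F ∈ u.range
  induction F using MvPolynomial.induction_on with
  | C a => rw [algHom_C]; exact u.range.algebraMap_mem a
  | add F G hF hG => rw [map_add]; exact add_mem hF hG
  | mul_X F s hF => rw [map_mul]; exact mul_mem hF (hX s)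

end Generation

/-! ### Divisibility between `p` and powers of `π`. -/

section Uniformizer

variable {p : ℕ} [Fact p.Prime] (E : EisensteinPoly p)

/-- The Eisenstein equation for `π`, with `p` divided out of the coefficients. -/
theorem Rpi.exists_unif_pow_add_eq_zero : ∃ (b : ℕ → Rpi E), IsUnit (b 0) ∧
    Rpi.unif E ^ E.poly.natDegree +
      ∑ i ∈ Finset.range E.poly.natDegree, p * b i * Rpi.unif E ^ i = 0 := by
  have h2 := E.two_le_natDegree
  have hc : ∀ i, ∃ t : ℤ_[p], i < E.poly.natDegree → E.poly.coeff i = p * t := fun i => by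
    by_cases hi : i < E.poly.natDegree
    · obtain ⟨t, ht⟩ := Ideal.mem_span_singleton.1 (E.eisenstein.mem hi)
      exact ⟨t, fun _ => ht⟩
    · exact ⟨0, fun h => absurd h hi⟩
  choose t ht using hc
  refine ⟨fun i => algebraMap (Rp p) (Rpi E) (padicToRp p (t i)), ?_, ?_⟩
  · refine IsUnit.map _ (IsUnit.map _ ?_)
    -- A non-unit here would make `p ^ 2` divide the constant coefficient of the Eisenstein
    -- polynomial.
    by_contra hn
    have hd : (p : ℤ_[p]) ∣ t 0 := by
      rw [← Ideal.mem_span_singleton, ← PadicInt.maximalIdeal_eq_span_p]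
      exact hn
    apply E.eisenstein.notMem
    rw [Ideal.span_singleton_pow, Ideal.mem_span_singleton, ht 0 (by omega), pow_two]
    exact mul_dvd_mul_left _ hd
  · have h0 : AdjoinRoot.mk E.polyRp E.polyRp = 0 := AdjoinRoot.mk_self
    have hdeg : E.polyRp.natDegree = E.poly.natDegree := E.monic.natDegree_map _
    have h1 := congrArg (AdjoinRoot.mk E.polyRp) (monic_polyRp E).as_sum
    rw [h0] at h1
    rw [map_add, map_pow, AdjoinRoot.mk_X, map_sum, hdeg] at h1
    rw [h1]
    refine congrArg₂ (· + ·) rfl (Finset.sum_congr rfl fun i hi => ?_)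
    have hcoeff : E.polyRp.coeff i = p * padicToRp p (t i) := by
      rw [EisensteinPoly.polyRp, Polynomial.coeff_map, ht i (Finset.mem_range.1 hi), map_mul,
        map_natCast]
    rw [map_mul, map_pow, AdjoinRoot.mk_X, AdjoinRoot.mk_C, hcoeff, map_mul, map_natCast]
    rfl

theorem Rpi.p_dvd_unif_pow : (p : Rpi E) ∣ Rpi.unif E ^ E.poly.natDegree := by
  obtain ⟨b, -, hb⟩ := Rpi.exists_unif_pow_add_eq_zero E
  rw [eq_neg_of_add_eq_zero_left hb, dvd_neg]
  exact Finset.dvd_sum fun i _ => by rw [mul_assoc]; exact dvd_mul_right _ _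

/-- Bootstrapping: the Eisenstein equation expresses `p b₀`, with `b₀` a unit, by `π ^ e` and terms
`p b_i π ^ i` with `i ≥ 1`. If `π ^ k ∣ p` and `k < e`, all of these are divisible by `π ^ (k+1)`.
-/
theorem Rpi.unif_pow_dvd_p {k : ℕ} (hk : k ≤ E.poly.natDegree) : Rpi.unif E ^ k ∣ (p : Rpi E) := by
  obtain ⟨b, hb0, hb⟩ := Rpi.exists_unif_pow_add_eq_zero E
  induction k with
  | zero => simp
  | succ k ih =>
    have ih := ih (by omega)
    obtain ⟨e, he⟩ : ∃ e, E.poly.natDegree = e + 1 := ⟨_, (Nat.succ_pred (by omega)).symm⟩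
    rw [he, Finset.sum_range_succ', pow_zero, mul_one, ← add_assoc] at hb
    rw [← hb0.dvd_mul_right, eq_neg_of_add_eq_zero_right hb, dvd_neg]
    refine dvd_add (pow_dvd_pow _ (by omega)) (Finset.dvd_sum fun i _ => ?_)
    rw [pow_succ, pow_succ, ← mul_assoc]
    exact mul_dvd_mul (((ih.mul_right _)).mul_right _) dvd_rfl

theorem Rpi.frob_unif : Rpi.frob E (Rpi.unif E) = Rpi.unif E := by
  rw [Rpi.frob, Rpi.unif, AdjoinRoot.lift_root]

end Uniformizer

/-! ### Iterates of `δ_π` in terms of `δ_p`. -/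

section IteratedDelta

variable {p : ℕ} [Fact p.Prime] (E : EisensteinPoly p) (A : Type) [CommRing A] [Algebra (Rp p) A]
  {σ : Type}

/-- One application of `δ_π` to a polynomial divisible by `π ^ (k + 1)`. -/
theorem delta_unif_pow_mul (n k : ℕ) (Q : JetPoly (Rpi E) σ n) :
    delta (basePi E) (basePi E).dvd_p n (C (Rpi.unif E ^ (k + 1)) * Q) =
      C (Rpi.unif E ^ k) * (Phi (basePi E) p σ n Q -
        C (Rpi.unif E ^ ((k + 1) * (p - 1))) * incl (Rpi E) σ n Q ^ p) := by
  apply cancel (basePi E)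
  -- Splits the power of `π` in `(π ^ (k+1) Q) ^ p` so that `π ^ (k+1)` is a common factor; the
  -- division in `δ_π` removes one `π` from it.
  have hp : (k + 1) * p = (k + 1) * (p - 1) + (k + 1) := by
    have := (Fact.out : p.Prime).one_le
    obtain ⟨q, rfl⟩ := Nat.exists_eq_add_of_le' this
    simp; ring
  have hi : ∀ a, incl (Rpi E) σ n (C a) = C a := fun a => rename_C _ _
  have hP : Phi (basePi E) (p : Rpi E) σ n (C (Rpi.unif E ^ (k + 1))) =
      C (Rpi.unif E ^ (k + 1)) := by
    rw [Phi, eval₂Hom_C, RingHom.comp_apply, map_pow]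
    exact congrArg (fun x => C (x ^ (k + 1))) (Rpi.frob_unif E)
  have hu : (basePi E).unif = Rpi.unif E := rfl
  rw [unif_mul_delta, map_mul, map_mul, hi, hP, mul_pow, ← C_pow, ← pow_mul, hp, hu]
  simp only [pow_add, pow_one, C_mul]
  ring

/-- The elements `δ_π ⁱ x_j` are, modulo the relations, images of polynomials `P` in the `δ_p ˡ x_j`
such that, for `i > 0`, the degree of `P` is at most `p ^ (i - 1)` and `π ^ (e - i)` divides `P`. -/
theorem exists_iterDelta_sub_ren_mem (x : σ → A) (j : σ) : ∀ (n : ℕ) (i : Fin (n + 1)),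
    ∃ P : JetPoly (Rpi E) σ n,
      (i = 0 → P = X (0, j)) ∧
      (∀ k : ℕ, (i : ℕ) = k + 1 → k + 1 ≤ E.poly.natDegree →
        ∃ Q : JetPoly (Rpi E) σ n,
          P = C (Rpi.unif E ^ (E.poly.natDegree - (k + 1))) * Q ∧ Q.totalDegree ≤ p ^ k) ∧
      iterDelta E A n i (1 ⊗ₜ x j) - ren (Rpi E) x n P ∈ extIdeal E A n
  | 0, i => by
    obtain rfl : i = 0 := Subsingleton.elim (α := Fin 1) _ _
    refine ⟨X (0, j), fun _ => rfl, fun k hk => absurd hk (by simp), ker_kappa_le E A ?_⟩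
    -- `iterDelta` starts from an arbitrary lift of `1 ⊗ x_j`; it differs from the variable by an
    -- element of the kernel of `kappa`.
    rw [RingHom.mem_ker, map_sub, iterDelta, Function.surjInv_eq (kappa_surjective E A), ren_X,
      kappa, aeval_X, sub_self]
  | n + 1, i => by
    induction i using Fin.lastCases with
    | cast i =>
      obtain ⟨P, h0, hk, hP⟩ := exists_iterDelta_sub_ren_mem x j n i
      refine ⟨incl (Rpi E) σ n P, fun h => ?_, fun k hik hke => ?_, ?_⟩
      · rw [h0 (by simpa using h), incl, rename_X]
        rfl
      · obtain ⟨Q, rfl, hQ⟩ := hk k (by simpa using hik) hke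
        refine ⟨incl (Rpi E) σ n Q, ?_, (totalDegree_rename_le _ _).trans hQ⟩
        rw [map_mul]
        congr 1
        exact rename_C _ _
      · rw [iterDelta_castSucc, ren_incl, ← map_sub]
        exact (extIdeal_stable E A n hP).1
    | last =>
      obtain ⟨P, h0, hk, hP⟩ := exists_iterDelta_sub_ren_mem x j n (Fin.last n)
      refine ⟨delta (basePi E) (basePi E).dvd_p n P, fun h => ?_, fun k hik hke => ?_, ?_⟩
      · exact absurd h (Fin.last_pos.ne')
      · obtain rfl : n = k := by simpa using hik
        cases n with
        | zero =>
          -- With `p = π ^ e w`, this is `δ_π x_j = π ^ (e-1) w δ_p x_j`.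
          obtain ⟨w, hw⟩ := Rpi.unif_pow_dvd_p E le_rfl
          rw [h0 rfl, delta_X (basePi E) (basePi E).dvd_p
            (a := Rpi.unif E ^ (E.poly.natDegree - 1) * w)]
          · refine ⟨C w * X (Fin.succ 0, j), by rw [C_mul, mul_assoc], ?_⟩
            have : Nontrivial (Rpi E) := AdjoinRoot.nontrivial _ (by
              rw [Polynomial.degree_eq_natDegree (monic_polyRp E).ne_zero,
                show E.polyRp.natDegree = E.poly.natDegree from E.monic.natDegree_map _]
              exact_mod_cast (by omega))
            refine (totalDegree_mul _ _).trans ?_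
            rw [totalDegree_C, totalDegree_X]
            simp
          · change _ = Rpi.unif E * _
            rw [← mul_assoc, ← pow_succ', Nat.sub_add_cancel (by omega), ← hw]
        | succ n =>
          obtain ⟨Q, rfl, hQ⟩ := hk n (by simp) (by omega)
          -- Since `n + 2 ≤ e`, the exponent of `π` reached so far is positive, so there is a factor
          -- `π` to spend on one more `δ_π`.
          obtain ⟨l, hl⟩ : ∃ l, E.poly.natDegree - (n + 1) = l + 1 :=
            ⟨_, (Nat.succ_pred (by omega)).symm⟩
          have hl' : E.poly.natDegree - (n + 1 + 1) = l := by omega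
          rw [hl, hl', delta_unif_pow_mul]
          refine ⟨_, rfl, (totalDegree_sub _ _).trans (max_le ?_ ?_)⟩
          · refine (totalDegree_Phi_le _ _ _ _).trans ?_
            rw [pow_succ']
            exact Nat.mul_le_mul_left _ hQ
          · refine (totalDegree_mul _ _).trans ?_
            rw [totalDegree_C, zero_add, pow_succ']
            exact (totalDegree_pow _ _).trans
              (Nat.mul_le_mul_left _ ((totalDegree_rename_le _ _).trans hQ))
      · rw [← Fin.succ_last, iterDelta_succ, ren_delta]
        exact delta_sub_mem (basePi E) _ (fun F hF => (extIdeal_stable E A n hF).1)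
          (fun F hF => (extIdeal_stable E A n hF).2) hP

end IteratedDelta

/-! ### Polynomials over `R_π` with linear growth of valuations. -/

section Growth

variable {p : ℕ} [Fact p.Prime] (E : EisensteinPoly p) {σ : Type} {n : ℕ}

/-- The degree of a monomial in the variables `δⁱ x_j` with `i > 0`. -/
def derDegree (α : Fin (n + 1) × σ →₀ ℕ) : ℕ := α.sum fun s k => if s.1 = 0 then 0 else k

theorem derDegree_add (α β : Fin (n + 1) × σ →₀ ℕ) :
    derDegree (α + β) = derDegree α + derDegree β := by
  classical
  exact Finsupp.sum_add_index' (fun s => by simp) (fun s k l => by split_ifs <;> simp)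

theorem derDegree_le (α : Fin (n + 1) × σ →₀ ℕ) : derDegree α ≤ α.sum fun _ k => k :=
  Finset.sum_le_sum fun s _ => by dsimp only; split_ifs <;> simp

theorem derDegree_le_totalDegree {R : Type} [CommRing R] {P : JetPoly R σ n}
    {α : Fin (n + 1) × σ →₀ ℕ} (h : α ∈ P.support) : derDegree α ≤ P.totalDegree :=
  (derDegree_le α).trans (le_totalDegree h)

/-- The polynomials over `R_π` in which the coefficient of a monomial of degree `b` in the
variables `δⁱ x_j`, `i > 0`, has `π`-adic valuation at least `b / K`. -/
def growthSubalgebra (σ : Type) (n : ℕ) {K : ℕ} (hK : 0 < K) :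
    Subalgebra (Rpi E) (JetPoly (Rpi E) σ n) where
  carrier := {P | ∀ α, Rpi.unif E ^ (derDegree α ⌈/⌉ K) ∣ coeff α P}
  add_mem' hP hQ α := by rw [coeff_add]; exact dvd_add (hP α) (hQ α)
  mul_mem' {P Q} hP hQ α := by
    classical
    rw [coeff_mul]
    refine Finset.dvd_sum fun b hb => ?_
    refine dvd_trans ?_ (mul_dvd_mul (hP b.1) (hQ b.2))
    rw [← pow_add]
    refine pow_dvd_pow _ ?_
    -- Closure under products is the subadditivity of the ceiling; a floor would go the wrong way.
    rw [ceilDiv_le_iff_le_mul hK, ← Finset.HasAntidiagonal.mem_antidiagonal.1 hb, derDegree_add,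
      mul_add]
    exact add_le_add ((ceilDiv_le_iff_le_mul hK).1 le_rfl) ((ceilDiv_le_iff_le_mul hK).1 le_rfl)
  algebraMap_mem' c α := by
    classical
    rw [algebraMap_eq, coeff_C]
    split_ifs with h
    · rw [← h]
      simp [derDegree]
    · exact dvd_zero _

theorem X_zero_mem_growthSubalgebra {K : ℕ} (hK : 0 < K) (j : σ) :
    X (0, j) ∈ growthSubalgebra E σ n hK := by
  classical
  intro α
  rw [coeff_X]
  split_ifs with h
  · rw [← h]
    simp [derDegree]
  · exact dvd_zero _

/-- Every monomial of `Q` has derivative degree at most `K`, so a single factor `π` is enough. -/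
theorem mem_growthSubalgebra_of_totalDegree_le {K : ℕ} (hK : 0 < K) {m : ℕ} (hm : 1 ≤ m)
    {Q : JetPoly (Rpi E) σ n} (hQ : Q.totalDegree ≤ K) :
    C (Rpi.unif E ^ m) * Q ∈ growthSubalgebra E σ n hK := by
  intro α
  rw [coeff_C_mul]
  by_cases hα : α ∈ Q.support
  · refine (pow_dvd_pow _ ?_).mul_right _
    rw [ceilDiv_le_iff_le_mul hK]
    exact ((derDegree_le_totalDegree hα).trans hQ).trans (Nat.le_mul_of_pos_right _ hm)
  · rw [notMem_support_iff.1 hα, mul_zero]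
    exact dvd_zero _

end Growth

/-! ### Functionals `R_π → R_p` applied to coefficients. -/

section Functional

variable {p : ℕ} [Fact p.Prime] {E : EisensteinPoly p} {τ : Type}

/-- The application of an `R_p`-linear functional on `R_π` to the coefficients of a polynomial. -/
def mapCoeff (lam : Rpi E →ₗ[Rp p] Rp p) (P : MvPolynomial τ (Rpi E)) : MvPolynomial τ (Rp p) :=
  ∑ α ∈ P.support, monomial α (lam (coeff α P))

theorem coeff_mapCoeff (lam : Rpi E →ₗ[Rp p] Rp p) (P : MvPolynomial τ (Rpi E)) (α : τ →₀ ℕ) :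
    coeff α (mapCoeff lam P) = lam (coeff α P) := by
  classical
  simp only [mapCoeff, coeff_sum, coeff_monomial]
  rw [Finset.sum_ite_eq' P.support α]
  split_ifs with h
  · rfl
  · rw [notMem_support_iff.1 h, map_zero]

/-- Although `lam` is only `R_p`-linear, monomials in the `1 ⊗ u (X t)` lie in `1 ⊗ D`, so it acts
on the coefficients alone. -/
theorem lid_rTensor_aeval (lam : Rpi E →ₗ[Rp p] Rp p) {D : Type} [CommRing D] [Algebra (Rp p) D]
    (u : MvPolynomial τ (Rp p) →ₐ[Rp p] D) (P : MvPolynomial τ (Rpi E)) :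
    TensorProduct.lid (Rp p) D (LinearMap.rTensor D lam
      (aeval (fun t => (1 : Rpi E) ⊗ₜ[Rp p] u (X t)) P)) = u (mapCoeff lam P) := by
  conv_lhs => rw [P.as_sum]
  simp only [map_sum, mapCoeff]
  refine Finset.sum_congr rfl fun α _ => ?_
  have h : (aeval (fun t => (1 : Rpi E) ⊗ₜ[Rp p] u (X t)) (monomial α (coeff α P)) :
      Rpi E ⊗[Rp p] D) = coeff α P ⊗ₜ u (monomial α 1) := by
    have h1 : ∀ t, (1 : Rpi E) ⊗ₜ[Rp p] u (X t) =
        (Algebra.TensorProduct.includeRight : D →ₐ[Rp p] Rpi E ⊗[Rp p] D) (u (X t)) := fun _ => rfl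
    rw [aeval_monomial, Algebra.TensorProduct.algebraMap_apply, Algebra.algebraMap_self_apply,
      monomial_eq, C_1, one_mul]
    simp only [h1, ← map_pow, Finsupp.prod, ← map_prod]
    simp
  rw [h, LinearMap.rTensor_tmul, TensorProduct.lid_tmul, ← map_smul, smul_monomial, smul_eq_mul,
    mul_one]

/-- Because `p ∣ π ^ e`, `π ^ m` contains `p ^ ⌊m/e⌋`, and an `R_p`-linear map lets powers of `p`
through. -/
theorem pow_dvd_functional (lam : Rpi E →ₗ[Rp p] Rp p) {m : ℕ} {c : Rpi E}
    (h : Rpi.unif E ^ m ∣ c) : (p : Rp p) ^ (m / E.poly.natDegree) ∣ lam c := by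
  have h1 : (p : Rpi E) ^ (m / E.poly.natDegree) ∣ c := by
    refine dvd_trans (pow_dvd_pow_of_dvd (Rpi.p_dvd_unif_pow E) _) (dvd_trans ?_ h)
    rw [← pow_mul]
    exact pow_dvd_pow _ (Nat.mul_div_le _ _)
  obtain ⟨t, rfl⟩ := h1
  refine ⟨lam t, ?_⟩
  rw [← smul_eq_mul (a := (p : Rp p) ^ _), ← map_smul, Algebra.smul_def, map_pow, map_natCast]

/-- A functional `R_π → R_p` with value `1` at `1`. -/
theorem exists_functional_one (E : EisensteinPoly p) :
    ∃ lam : Rpi E →ₗ[Rp p] Rp p, lam 1 = 1 := by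
  let b := AdjoinRoot.powerBasis' (monic_polyRp E)
  have hdim : 0 < b.dim := by
    have h1 : b.dim = E.polyRp.natDegree := rfl
    have h2 : E.polyRp.natDegree = E.poly.natDegree := E.monic.natDegree_map _
    have := E.two_le_natDegree
    omega
  refine ⟨b.basis.coord ⟨0, hdim⟩, ?_⟩
  have h : b.basis ⟨0, hdim⟩ = 1 := by rw [b.basis_eq_pow, pow_zero]
  rw [← h, Module.Basis.coord_apply, Module.Basis.repr_self, Finsupp.single_eq_same]

end Functional

/-! ### The affine case. -/

section Affine

variable {p : ℕ} [Fact p.Prime] {E : EisensteinPoly p} {A : Type} [CommRing A] [Algebra (Rp p) A]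
  {σ : Type}

theorem aeval_one_tmul_surjective {x : σ → A}
    (hx : Function.Surjective (aeval x : MvPolynomial σ (Rp p) →ₐ[Rp p] A)) :
    Function.Surjective (aeval (fun j => (1 : Rpi E) ⊗ₜ[Rp p] x j) :
      MvPolynomial σ (Rpi E) →ₐ[Rpi E] Rpi E ⊗[Rp p] A) := by
  intro z
  induction z using TensorProduct.induction_on with
  | zero => exact ⟨0, map_zero _⟩
  | tmul c a =>
    obtain ⟨P, rfl⟩ := hx a
    refine ⟨C c * MvPolynomial.map (algebraMap (Rp p) (Rpi E)) P, ?_⟩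
    have h : (1 : Rpi E) ⊗ₜ[Rp p] aeval x P =
        aeval (fun j => (1 : Rpi E) ⊗ₜ[Rp p] x j) P :=
      comp_aeval_apply x (Algebra.TensorProduct.includeRight : A →ₐ[Rp p] Rpi E ⊗[Rp p] A) P
    rw [map_mul, aeval_map_algebraMap, ← h, algHom_C, Algebra.TensorProduct.algebraMap_apply,
      Algebra.TensorProduct.tmul_mul_tmul]
    simp
  | add x y hx hy =>
    obtain ⟨F, rfl⟩ := hx
    obtain ⟨G, rfl⟩ := hy
    exact ⟨F + G, map_add _ _ _⟩

/-- The comparison map in coordinates: `δ_π ⁱ x_j` is expressed by polynomials in the `δ_p ˡ x_j`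
of controlled growth. -/
theorem exists_toPJetAlg_eq {r : ℕ} (hr : 1 ≤ r) (hre : r ≤ E.poly.natDegree - 1) (x : σ → A)
    (hK : 0 < p ^ (r - 1)) :
    ∃ T : JetPoly (Rpi E) σ r →ₐ[Rpi E] JetPoly (Rpi E) σ r,
      (∀ G, T G ∈ growthSubalgebra E σ r hK) ∧
      ∀ G, toPJetAlg E A r (aeval (fun t : Fin (r + 1) × σ => JetAlg.mk (basePi E)
          (Rpi E ⊗[Rp p] A) r (X (t.1, (1 : Rpi E) ⊗ₜ[Rp p] x t.2))) G) =
        aeval (fun t : Fin (r + 1) × σ => (1 : Rpi E) ⊗ₜ[Rp p]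
          JetAlg.mk (baseP p) A r (X (t.1, x t.2))) (T G) := by
  choose P hP0 hPk hP using fun t : Fin (r + 1) × σ =>
    exists_iterDelta_sub_ren_mem E A x t.2 r t.1
  refine ⟨aeval P, fun G => ?_, fun G => ?_⟩
  · have hle : (aeval P : JetPoly (Rpi E) σ r →ₐ[Rpi E] _).range ≤ growthSubalgebra E σ r hK := by
      rw [← Algebra.adjoin_range_eq_range_aeval]
      refine Algebra.adjoin_le ?_
      rintro _ ⟨⟨i, j⟩, rfl⟩
      induction i using Fin.cases with
      | zero =>
        rw [hP0 (0, j) rfl]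
        exact X_zero_mem_growthSubalgebra E hK j
      | succ k =>
        -- The index is `k + 1 ≤ r ≤ e - 1`: hence the exponent `e - (k + 1)` is at least 1, and the
        -- degree is at most `p ^ k ≤ p ^ (r - 1)`.
        obtain ⟨Q, hQ, hd⟩ := hPk (k.succ, j) k (by simp) (by omega)
        rw [hQ]
        refine mem_growthSubalgebra_of_totalDegree_le E hK (by omega) (hd.trans ?_)
        exact Nat.pow_le_pow_right (Fact.out : p.Prime).pos (by omega)
    exact hle ⟨G, rfl⟩
  · rw [← AlgHom.comp_apply, ← AlgHom.comp_apply]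
    congr 1
    ext t
    rw [AlgHom.comp_apply, AlgHom.comp_apply, aeval_X, aeval_X]
    have h1 : toPJetAlg E A r (JetAlg.mk (basePi E) (Rpi E ⊗[Rp p] A) r
        (X (t.1, (1 : Rpi E) ⊗ₜ[Rp p] x t.2))) =
        toTensor E A r (theta E A r (X (t.1, (1 : Rpi E) ⊗ₜ[Rp p] x t.2))) := rfl
    have h2 := extIdeal_le_ker E A r (hP t)
    rw [RingHom.mem_ker, map_sub, sub_eq_zero] at h2
    rw [h1, theta, aeval_X]
    refine h2.trans ?_
    rw [ren, toTensor, aeval_rename]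
    rfl

theorem lid_rTensor_map_of (lam : Rpi E →ₗ[Rp p] Rp p) {D : Type} [CommRing D] [Algebra (Rp p) D]
    (z : Rpi E ⊗[Rp p] D) :
    TensorProduct.lid (Rp p) (PHat p D) (LinearMap.rTensor _ lam
      (Algebra.TensorProduct.map (AlgHom.id (Rp p) (Rpi E))
        (PHat.of p : D →ₐ[Rp p] PHat p D) z)) =
      algebraMap D (PHat p D) (TensorProduct.lid (Rp p) D (LinearMap.rTensor _ lam z)) := by
  induction z using TensorProduct.induction_on with
  | zero => simp only [map_zero]
  | tmul c a =>
    rw [Algebra.TensorProduct.map_tmul, LinearMap.rTensor_tmul, LinearMap.rTensor_tmul,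
      TensorProduct.lid_tmul, TensorProduct.lid_tmul]
    exact (map_smul (PHat.of p : D →ₐ[Rp p] PHat p D) _ _).symm
  | add x y hx hy => simp only [map_add, hx, hy]

/-- A series whose `p ^ ν`-multiple differs by a polynomial from an overconvergent series is
overconvergent. -/
theorem isOverconvergentSeries_of_pow_mul {r d : ℕ} {ρ : ℝ} (hρ : 0 ≤ Real.logb p ρ)
    {F F' : MvPowerSeries (Fin (r + 1) × Fin d) (Rp p)} (hF : IsRestrictedSeries F)
    (hF' : IsRestrictedSeries F') {P : JetPoly (Rp p) (Fin d) r} {ν : ℕ}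
    (h : (p : PHat p (JetPoly (Rp p) (Fin d) r)) ^ ν * hF.toPHat =
      hF'.toPHat - algebraMap _ _ P) {c : ℝ} (hc : 0 ≤ c)
    (hov : ∀ α, ∃ v : ℕ, Real.logb p ρ * (derDegree α : ℝ) - c ≤ v ∧
      (p : Rp p) ^ v ∣ MvPowerSeries.coeff α F') : IsOverconvergentSeries ρ F := by
  have hcoeff : ∀ α, (p : Rp p) ^ ν * MvPowerSeries.coeff α F =
      MvPowerSeries.coeff α F' - coeff α P := by
    intro α
    rw [← sub_eq_zero]
    refine Rp.eq_zero_of_forall_dvd fun m => ?_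
    have h1 := congrArg (AdicCompletion.evalₐ (Ideal.span {(p : JetPoly (Rp p) (Fin d) r)}) m) h
    rw [map_mul, map_pow, map_natCast, map_sub, hF.evalₐ_toPHat, hF'.evalₐ_toPHat,
      PHat.evalₐ_algebraMap, ← map_natCast (Ideal.Quotient.mk _), ← map_pow, ← map_mul, ← map_sub,
      quotient_mk_eq_iff, pow_dvd_iff_coeff] at h1
    have h2 := h1 α
    rw [coeff_sub, coeff_sub, ← map_natCast C, ← C_pow, coeff_C_mul] at h2
    have h3 := (dvd_coeff_truncSeries_sub hF m α).mul_left ((p : Rp p) ^ ν)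
    have h4 := dvd_coeff_truncSeries_sub hF' m α
    convert dvd_add (dvd_sub h2 h3) h4 using 1
    ring
  -- `ν` pays for the division by `p ^ ν`, the term in `P.totalDegree` for the monomials of `P`, and
  -- `1` makes the constant positive.
  refine ⟨c + ν + Real.logb p ρ * P.totalDegree + 1, by positivity, fun α => ?_⟩
  change ∃ v : ℕ, Real.logb p ρ * (derDegree α : ℝ) - _ ≤ v ∧ _
  by_cases hα : α ∈ P.support
  · refine ⟨0, ?_, by simp⟩
    have : (derDegree α : ℝ) ≤ P.totalDegree := by exact_mod_cast derDegree_le_totalDegree hα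
    have := mul_le_mul_of_nonneg_left this hρ
    have : (0 : ℝ) ≤ ν := Nat.cast_nonneg _
    push_cast
    linarith
  · obtain ⟨v, hv, hd⟩ := hov α
    -- Truncated subtraction: for `v ≤ ν` the exponent is `0` and nothing has to be divisible.
    refine ⟨v - ν, ?_, ?_⟩
    · have h1 : (v : ℝ) ≤ ((v - ν : ℕ) : ℝ) + ν := by exact_mod_cast (by omega : v ≤ v - ν + ν)
      have : 0 ≤ Real.logb p ρ * (P.totalDegree : ℝ) := by positivity
      linarith
    · have h1 := hcoeff α
      rw [notMem_support_iff.1 hα, sub_zero] at h1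
      rw [← h1] at hd
      rcases le_total ν v with hle | hle
      · rw [← Nat.add_sub_cancel' hle, pow_add] at hd
        exact (mul_dvd_mul_iff_left (pow_ne_zero _ (WittVector.p_nonzero p _))).1 hd
      · rw [Nat.sub_eq_zero_of_le hle, pow_zero]
        exact one_dvd _

/-- Overconvergence in the affine case: if a functional on `R_π` takes the image of a function on
the `π`-jet space to `p ^ ν f`, then `f` lifts to an overconvergent series. -/
theorem exists_overconvergent_lift {r d : ℕ} (hr : 1 ≤ r) (hre : r ≤ E.poly.natDegree - 1)
    {x : Fin d → A} (hx : Function.Surjective (aeval x : MvPolynomial (Fin d) (Rp p) →ₐ[Rp p] A))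
    (lam : Rpi E →ₗ[Rp p] Rp p) {f : PHat p (JetAlg (baseP p) A r)} {ν : ℕ}
    (g : PHat p (JetAlg (basePi E) (Rpi E ⊗[Rp p] A) r))
    (h : TensorProduct.lid (Rp p) _ (LinearMap.rTensor _ lam (toPJet E A r g)) =
      (p : PHat p (JetAlg (baseP p) A r)) ^ ν * f) :
    ∃ (F : MvPowerSeries (Fin (r + 1) × Fin d) (Rp p)) (hF : IsRestrictedSeries F),
      IsOverconvergentSeries
        ((p : ℝ) ^ (((p : ℝ) ^ (r - 1) * (E.poly.natDegree : ℝ))⁻¹)) F ∧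
        affineJetMap x r hF.toPHat = f := by
  have hp := (Fact.out : p.Prime)
  have hp0 : (0 : ℝ) < p := by exact_mod_cast hp.pos
  have hK : 0 < p ^ (r - 1) := pow_pos hp.pos _
  have he : 0 < E.poly.natDegree := by omega
  have hlog : Real.logb p ((p : ℝ) ^ (((p : ℝ) ^ (r - 1) * (E.poly.natDegree : ℝ))⁻¹)) =
      ((p : ℝ) ^ (r - 1) * (E.poly.natDegree : ℝ))⁻¹ :=
    Real.logb_rpow hp0 (by exact_mod_cast hp.one_lt.ne')
  set u : JetPoly (Rp p) (Fin d) r →ₐ[Rp p] JetAlg (baseP p) A r :=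
    aeval fun t : Fin (r + 1) × Fin d => JetAlg.mk (baseP p) A r (X (t.1, x t.2)) with hu
  have husurj : Function.Surjective u.toRingHom := aeval_jet_surjective (baseP p) hx r
  set w : JetPoly (Rpi E) (Fin d) r →ₐ[Rpi E] JetAlg (basePi E) (Rpi E ⊗[Rp p] A) r :=
    aeval fun t : Fin (r + 1) × Fin d => JetAlg.mk (basePi E) (Rpi E ⊗[Rp p] A) r
      (X (t.1, (1 : Rpi E) ⊗ₜ[Rp p] x t.2)) with hw
  have hwsurj : Function.Surjective w.toRingHom :=
    aeval_jet_surjective (basePi E) (aeval_one_tmul_surjective hx) r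
  obtain ⟨T, hT, hTeq⟩ := exists_toPJetAlg_eq (A := A) hr hre x hK
  obtain ⟨G, rfl⟩ := PHat.map_surjective p hwsurj g
  obtain ⟨z, rfl⟩ := PHat.exists_eq_series p G
  have hseries : PHat.map p u.toRingHom (PHat.series p fun k => mapCoeff lam (T (z k))) =
      (p : PHat p (JetAlg (baseP p) A r)) ^ ν * f := by
    rw [← h, PHat.map_series]
    symm
    refine PHat.addHom_series p
      (((TensorProduct.lid (Rp p) _).toLinearMap ∘ₗ LinearMap.rTensor _ lam).toAddMonoidHom.comp
        ((toPJet E A r).comp (PHat.map p w.toRingHom)).toAddMonoidHom) z _ fun k => ?_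
    change TensorProduct.lid (Rp p) _ (LinearMap.rTensor _ lam
      (toPJet E A r (PHat.map p w.toRingHom (algebraMap _ _ (z k))))) = _
    rw [PHat.map_algebraMap, toPJet, PHat.lift_algebraMap]
    refine (lid_rTensor_map_of lam (toPJetAlg E A r (w (z k)))).trans (congrArg _ ?_)
    rw [hw, hTeq]
    have h1 := lid_rTensor_aeval lam u (T (z k))
    simp only [hu, aeval_X] at h1
    exact h1
  obtain ⟨F', hF', hF'eq⟩ := exists_restrictedSeries (PHat.series p fun k => mapCoeff lam (T (z k)))
  obtain ⟨F₀, rfl⟩ := PHat.map_surjective p husurj f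
  -- Both terms of the difference map to `p ^ ν f`, so it lies in the kernel. The summand `p ^ ν y`
  -- is then moved into the lift of `f`.
  obtain ⟨P, y, hP, hy, hPy⟩ := PHat.exists_eq_add_of_map_eq_zero p husurj
    (x := PHat.series p (fun k => mapCoeff lam (T (z k))) - (p : PHat p _) ^ ν * F₀) (by
      rw [map_sub, hseries, map_mul, map_pow, map_natCast, sub_self]) ν
  obtain ⟨F, hF, hFeq⟩ := exists_restrictedSeries (F₀ + y)
  refine ⟨F, hF, ?_, ?_⟩
  · refine isOverconvergentSeries_of_pow_mul (by rw [hlog]; positivity) hF hF' (P := P) (ν := ν) ?_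
      zero_le_one fun α => ?_
    · rw [hFeq, hF'eq, mul_add, ← sub_eq_iff_eq_add'.2 hPy]
      ring
    -- `⌊⌈b/K⌉/e⌋ ≥ b/(K e) - 1` with `K = p ^ (r - 1)`, whence the constant `1`.
    · refine ⟨(derDegree α ⌈/⌉ p ^ (r - 1)) / E.poly.natDegree, ?_, ?_⟩
      · rw [hlog]
        have h1 : derDegree α ≤ p ^ (r - 1) * (derDegree α ⌈/⌉ p ^ (r - 1)) :=
          (ceilDiv_le_iff_le_mul hK).1 le_rfl
        set c := derDegree α ⌈/⌉ p ^ (r - 1)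
        have h2 : c ≤ E.poly.natDegree * (c / E.poly.natDegree + 1) :=
          (Nat.lt_mul_div_succ c he).le
        have h3 : derDegree α ≤ p ^ (r - 1) * E.poly.natDegree * (c / E.poly.natDegree + 1) := by
          rw [mul_assoc]
          exact h1.trans (Nat.mul_le_mul_left _ h2)
        have h4 : (derDegree α : ℝ) ≤ ((p : ℝ) ^ (r - 1) * E.poly.natDegree) *
            ((c / E.poly.natDegree : ℕ) + 1) := by exact_mod_cast h3
        rw [sub_le_iff_le_add, inv_mul_le_iff₀ (by positivity)]
        exact h4
      · set v := (derDegree α ⌈/⌉ p ^ (r - 1)) / E.poly.natDegree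
        -- Modulo `p ^ v` the coefficient of `F'` is that of a finite partial sum, each term of
        -- which is divisible by `p ^ v` by the growth condition.
        have h1 := hF'.dvd_coeff_sub ((congrArg _ hF'eq).trans (PHat.evalₐ_series p _ v)) α
        refine (dvd_iff_dvd_of_dvd_sub h1).2 ?_
        rw [coeff_sum]
        refine Finset.dvd_sum fun k _ => ?_
        rw [← map_natCast C, ← C_pow, coeff_C_mul, coeff_mapCoeff]
        exact (pow_dvd_functional lam (hT (z k) α)).mul_left _
  · rw [hFeq]
    change PHat.map p u.toRingHom (F₀ + y) = _
    rw [map_add, hy, add_zero]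

end Affine

/-! ### Closed embeddings in affine space. -/

section Embedding

open AlgebraicGeometry CategoryTheory

variable {p : ℕ} [Fact p.Prime] {V : Scheme.{0}} (s : V ⟶ Spec (CommRingCat.of (Rp p)))

/-- The coordinate functions of a closed embedding in affine space generate the ring of
functions. -/
theorem aeval_embCoord_surjective (W : V.Opens) {d : ℕ}
    (j : (W : Scheme) ⟶ 𝔸(Fin d; Spec (CommRingCat.of (Rp p)))) [IsClosedImmersion j]
    (hj : j ≫ (𝔸(Fin d; Spec (CommRingCat.of (Rp p))) ↘ Spec (CommRingCat.of (Rp p))) =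
      W.ι ≫ s) :
    Function.Surjective
      (aeval (embCoord s W j) : MvPolynomial (Fin d) (Rp p) →ₐ[Rp p] Sec s W) := by
  have hjs : Function.Surjective j.appTop :=
    (IsClosedImmersion.isAffine_surjective_of_isAffine j).2
  set q := CommRingCat.ofHom (eval₂Hom ((Scheme.ΓSpecIso (CommRingCat.of (Rp p))).inv ≫
    (𝔸(Fin d; Spec (CommRingCat.of (Rp p))) ↘ Spec (CommRingCat.of (Rp p))).appTop).hom
      (AffineSpace.coord (Spec (CommRingCat.of (Rp p))))) with hq
  have hqs : Function.Surjective q := by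
    have : q = (Scheme.ΓSpecIso _).inv ≫
        (AffineSpace.SpecIso (Fin d) (CommRingCat.of (Rp p))).hom.appTop := by
      rw [AffineSpace.SpecIso_hom_appTop, Iso.inv_hom_id_assoc]
    have h1 : IsIso (AffineSpace.SpecIso (Fin d) (CommRingCat.of (Rp p))).hom.appTop :=
      inferInstanceAs (IsIso (Scheme.Γ.map
        (AffineSpace.SpecIso (Fin d) (CommRingCat.of (Rp p))).hom.op))
    have : IsIso q := by rw [this]; exact IsIso.comp_isIso' inferInstance h1
    exact (ConcreteCategory.bijective_of_isIso q).2
  have hts : Function.Surjective W.topIso.hom := (ConcreteCategory.bijective_of_isIso _).2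
  have hιW : W.ι.appTop ≫ W.topIso.hom = V.presheaf.map (homOfLE (le_top : W ≤ ⊤)).op := by
    rw [Scheme.Opens.ι_appTop]
    exact (V.presheaf.map_comp _ _).symm
  have hbase := congrArg Scheme.Hom.appTop hj
  rw [Scheme.Hom.comp_appTop, Scheme.Hom.comp_appTop] at hbase
  -- Compatibility of `j` with the structure maps to `Spec R_p`, on global sections: it identifies
  -- the action of constants with the algebra structure on `Sec s W`.
  have hbase' := congrArg (fun t => (Scheme.ΓSpecIso (CommRingCat.of (Rp p))).inv ≫ t ≫
    W.topIso.hom) hbase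
  simp only [Category.assoc] at hbase'
  rw [hιW] at hbase'
  have heq : (q ≫ j.appTop ≫ W.topIso.hom).hom =
      (aeval (embCoord s W j) : MvPolynomial (Fin d) (Rp p) →ₐ[Rp p] Sec s W).toRingHom := by
    apply MvPolynomial.ringHom_ext
    · intro a
      have h1 : q.hom (C a) = ((Scheme.ΓSpecIso (CommRingCat.of (Rp p))).inv ≫
          (𝔸(Fin d; Spec (CommRingCat.of (Rp p))) ↘ Spec (CommRingCat.of (Rp p))).appTop).hom a :=
        eval₂Hom_C _ _ _
      refine Eq.trans (congrArg (fun t => W.topIso.hom (j.appTop t)) h1) ?_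
      refine Eq.trans (ConcreteCategory.congr_hom hbase' a) ?_
      exact (algHom_C (aeval (embCoord s W j)) a).symm
    · intro i
      have h1 : q.hom (X i) = AffineSpace.coord (Spec (CommRingCat.of (Rp p))) i :=
        eval₂Hom_X' _ _ _
      refine Eq.trans (congrArg (fun t => W.topIso.hom (j.appTop t)) h1) ?_
      exact (aeval_X (embCoord s W j) i).symm
  intro a
  obtain ⟨b, rfl⟩ := hts a
  obtain ⟨c, rfl⟩ := hjs b
  obtain ⟨P, rfl⟩ := hqs c
  exact ⟨P, (DFunLike.congr_fun heq P).symm⟩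

end Embedding

end ArithJet

end

theorem proposition2p9 (p : ℕ) [Fact p.Prime] (E : ArithJet.EisensteinPoly p)
    (V : AlgebraicGeometry.Scheme.{0})
    (s : V ⟶ AlgebraicGeometry.Spec (CommRingCat.of (ArithJet.Rp p)))
    [AlgebraicGeometry.Smooth s] (r : ℕ) (hr : 1 ≤ r) (hre : r ≤ E.poly.natDegree - 1)
    (f : ArithJet.pJetFunctions s r) (hf : ArithJet.IsDeltaPiOverconvergent s E f) :
    ArithJet.IsDeltaPOverconvergent s
      ((p : ℝ) ^ (((p : ℝ) ^ (r - 1) * (E.poly.natDegree : ℝ))⁻¹)) f := by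
  intro W d j hcl hj
  have hx := ArithJet.aeval_embCoord_surjective s W.1 j hj
  rcases hf with ⟨ν, g, hg⟩ | ⟨ν, g, hg⟩
  -- `arithTrace` is by definition the functional map for the trace.
  · exact ArithJet.exists_overconvergent_lift hr hre hx (Algebra.trace _ _) (g.1 W) (hg W)
  -- A functional with value `1` at `1` retracts `1 ⊗ p ^ ν f` to `p ^ ν f`.
  · obtain ⟨lam, hlam⟩ := ArithJet.exists_functional_one E
    refine ArithJet.exists_overconvergent_lift (ν := ν) hr hre hx lam (g.1 W) ?_
    rw [hg W, LinearMap.rTensor_tmul, TensorProduct.lid_tmul, hlam, one_smul]
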